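/- Let $q_1,q_2\in\mathbb C$ and let $\tilde V_{hh'}\in\mathbb C\cup\{-\infty\}$ ($h,h'=0,1,2,\dots$, with $e^{-\infty}:=0$) be such that all the bimoments $$\tilde g_{km}=\sum_{h,h'\ge 0}q_1^{kh}q_2^{mh'}e^{\tilde V_{hh'}},\qquad k,m=0,1,2,\dots,$$ are absolutely convergent sums over pairs of nonnegative integers $(h,h')$. For $n\ge 0$ consider the partition function of the discrete model $$Z^{\rm discr}_n(\tilde V;\tilde{\bf t},\tilde{\bf t}';q_1,q_2)=\frac1{n!}\sum_{h,h'}\Delta(q_1^{h})\Delta(q_2^{h'})\prod_{i=1}^n e^{\xi(\tilde{\bf t},q_1^{h_i})+\xi(\tilde{\bf t}',q_2^{h'_i})}e^{\tilde V_{h_ih'_i}},$$ where $h=(h_1,\dots,h_n)$ and $h'=(h'_1,\dots,h'_n)$ run over all $n$-tuples of nonnegative integers, $\Delta(q^h)=\prod_{i<j}(q^{h_i}-q^{h_j})$ and $\xi({\bf t},x)=\sum_{m\ge1}t_mx^m$. It is understood as its perturbation series: each term is expanded as a formal power series in $\tilde{\bf t}=(\tilde t_1,\tilde t_2,\dots)$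 and $\tilde{\bf t}'=(\tilde t'_1,\tilde t'_2,\dots)$, and the terms are summed coefficient by coefficient. Then these sums converge absolutely, and for every $n\ge0$ $$Z^{\rm discr}_n(\tilde V;\tilde{\bf t},\tilde{\bf t}';q_1,q_2)=\sum_{\lambda,\lambda':\ \ell(\lambda),\ell(\lambda')\le n}\det\bigl(\tilde g_{\tilde h_k\tilde h'_m}\bigr)_{k,m=1,\dots,n}\,s_\lambda(\tilde{\bf t})\,s_{\lambda'}(\tilde{\bf t}'),\qquad \tilde h_i=\lambda_i-i+n,\quad \tilde h'_i=\lambda'_i-i+n,$$ where the sum is over pairs of partitions, $s_\lambda({\bf t})=\det\bigl(h_{\lambda_i-i+j}({\bf t})\bigr)_{1\le i,j\le\ell(\lambda)}$, $\sum_{k\ge0}z^kh_k({\bf t})=\exp\sum_{m\ge1}z^mt_m$ and $h_k=0$ for $k<0$. Hence $\tau(n,\tilde{\bf t},\tilde{\bf t}')=Z^{\rm discr}_n$ is a tau function of the (semi-infinite) two-dimensional Toda lattice hierarchy, of Takasaki form: the matrix $(\tilde g_{km})_{k,m\ge0}$ does not depend on $n$ or on the times, and, with $\tau(n,\cdot,\cdot):=0$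 for $n<0$ and $[u]:=(u,u^2/2,u^3/3,\dots)$, the bilinear identities of the hierarchy $$\mathop{\rm Res}_z z^{n-m-1}\tau(n,{\bf t}-[z^{-1}],{\bf t}')\,\tau(m+1,{\bf s}+[z^{-1}],{\bf s}')\,e^{\xi({\bf t}-{\bf s},z)} =\mathop{\rm Res}_z z^{m-n-1}\tau(n+1,{\bf t},{\bf t}'+[z^{-1}])\,\tau(m,{\bf s},{\bf s}'-[z^{-1}])\,e^{\xi({\bf s}'-{\bf t}',z)}$$ hold for all integers $n,m$ as formal power series in ${\bf t},{\bf t}',{\bf s},{\bf s}'$, where $\mathop{\rm Res}_z$ is the coefficient of $z^{-1}$. -/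

import Mathlib

open scoped MvPowerSeries.WithPiTopology

namespace DiscreteToda

noncomputable section

/-! ## Schur functions in the times `t₁, t₂, …`

A partition is a `YoungDiagram`; its parts are `μ.rowLen 0 ≥ μ.rowLen 1 ≥ …` (rows are counted
from `0`) and its length is `μ.colLen 0`. -/

/-- The elementary Schur polynomial `h_k(t)`, defined by
`∑_{k ≥ 0} z ^ k h_k(t) = exp (∑_{m ≥ 1} z ^ m t_m)`. -/
def elemSchurNat (k : ℕ) : MvPolynomial ℕ+ ℂ :=
  PowerSeries.coeff k
    ((PowerSeries.exp ℂ).subst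
      (PowerSeries.mk fun m : ℕ =>
        if hm : 0 < m then (MvPolynomial.X ⟨m, hm⟩ : MvPolynomial ℕ+ ℂ) else 0))

/-- `h_k(t)` for integer `k`, with `h_k = 0` for `k < 0`. -/
def elemSchur (k : ℤ) : MvPolynomial ℕ+ ℂ :=
  if 0 ≤ k then elemSchurNat k.toNat else 0

/-- The Schur function `s_μ(t) = det (h_{μ_i - i + j}(t))`, `1 ≤ i, j ≤ ℓ(μ)`. -/
def schur (μ : YoungDiagram) : MvPolynomial ℕ+ ℂ :=
  Matrix.det (Matrix.of fun i j : Fin (μ.colLen 0) =>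
    elemSchur ((μ.rowLen i : ℤ) - (i : ℕ) + (j : ℕ)))

/-- Partitions of length at most `n`. -/
abbrev PartitionLE (n : ℕ) : Type := {μ : YoungDiagram // μ.colLen 0 ≤ n}

/-- The numbers `μ_i - i + n`, `1 ≤ i ≤ n`; with `i` counted from `0` they read
`μ_i + (n - 1 - i)`. -/
def shiftedPart {n : ℕ} (μ : PartitionLE n) (i : Fin n) : ℕ :=
  μ.1.rowLen i + (n - 1 - (i : ℕ))

/-! ## Formal power series in the two sequences of times -/

/-- The coupling constants: `Sum.inl m` is `t_m` and `Sum.inr m` is `t'_m`, for `m ≥ 1`. -/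
abbrev Time : Type := ℕ+ ⊕ ℕ+

/-- `s_μ(t)` as a formal power series in `t, t'`. -/
def schurLeft (μ : YoungDiagram) : MvPowerSeries Time ℂ :=
  (MvPolynomial.rename Sum.inl (schur μ) : MvPolynomial Time ℂ)

/-- `s_μ(t')` as a formal power series in `t, t'`. -/
def schurRight (μ : YoungDiagram) : MvPowerSeries Time ℂ :=
  (MvPolynomial.rename Sum.inr (schur μ) : MvPolynomial Time ℂ)

/-- `ξ(t, x) + ξ(t', y) = ∑_{m ≥ 1} t_m x ^ m + ∑_{m ≥ 1} t'_m y ^ m`. -/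
def xiSum (x y : ℂ) : MvPowerSeries Time ℂ :=
  (∑' m : ℕ+, MvPowerSeries.C (x ^ (m : ℕ)) * MvPowerSeries.X (Sum.inl m)) +
    ∑' m : ℕ+, MvPowerSeries.C (y ^ (m : ℕ)) * MvPowerSeries.X (Sum.inr m)

/-- The formal power series `e ^ {ξ(t, x) + ξ(t', y)}`. -/
def expXi (x y : ℂ) : MvPowerSeries Time ℂ :=
  (PowerSeries.exp ℂ).subst (xiSum x y)

/-! ## The discrete model -/

/-- `e ^ v` for `v ∈ ℂ ∪ {-∞}`, with `e ^ {-∞} = 0`. -/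
def expPot : WithBot ℂ → ℂ :=
  WithBot.recBotCoe 0 Complex.exp

/-- `Δ(x) = ∏_{i < j} (x_i - x_j)`. -/
def vand {n : ℕ} (x : Fin n → ℂ) : ℂ :=
  ∏ i : Fin n, ∏ j ∈ Finset.Ioi i, (x i - x j)

/-- The term of the discrete model attached to `n`-tuples `h, h'`, expanded in `t, t'`:
`Δ(q₁^h) Δ(q₂^h') ∏ e^{ξ(t, q₁^{h_i}) + ξ(t', q₂^{h'_i})} e^{V_{h_i h'_i}}`. -/
def modelTerm (q₁ q₂ : ℂ) (V : ℕ → ℕ → WithBot ℂ) (n : ℕ) (h h' : Fin n → ℕ) :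
    MvPowerSeries Time ℂ :=
  MvPowerSeries.C (vand (fun i => q₁ ^ h i) * vand (fun i => q₂ ^ h' i)) *
    ∏ i : Fin n, expXi (q₁ ^ h i) (q₂ ^ h' i) * MvPowerSeries.C (expPot (V (h i) (h' i)))

/-- The perturbation series of the partition function of the discrete model: `1 / n!` times the
sum over all `h, h'` of the expanded terms, coefficient by coefficient. -/
def partitionFn (q₁ q₂ : ℂ) (V : ℕ → ℕ → WithBot ℂ) (n : ℕ) : MvPowerSeries Time ℂ :=
  MvPowerSeries.C (1 / (n.factorial : ℂ)) *
    ∑' p : (Fin n → ℕ) × (Fin n → ℕ), modelTerm q₁ q₂ V n p.1 p.2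

/-- The summand `q₁^{k a} q₂^{m b} e^{V_{ab}}`, `(a, b) ∈ ℕ × ℕ`, of the bimoment. -/
def bimomentTerm (q₁ q₂ : ℂ) (V : ℕ → ℕ → WithBot ℂ) (k m : ℕ) (p : ℕ × ℕ) : ℂ :=
  q₁ ^ (k * p.1) * q₂ ^ (m * p.2) * expPot (V p.1 p.2)

/-- The discrete bimoment `g_{km} = ∑_{a, b ≥ 0} q₁^{k a} q₂^{m b} e^{V_{ab}}`. -/
def bimoment (q₁ q₂ : ℂ) (V : ℕ → ℕ → WithBot ℂ) (k m : ℕ) : ℂ :=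
  ∑' p : ℕ × ℕ, bimomentTerm q₁ q₂ V k m p

/-- `det (G_{h_k h'_m})_{k, m = 1, …, n}` with `h_i = μ_i - i + n`, `h'_i = ν_i - i + n`. -/
def coeffDet (G : ℕ → ℕ → ℂ) {n : ℕ} (μ ν : PartitionLE n) : ℂ :=
  Matrix.det (Matrix.of fun i j : Fin n => G (shiftedPart μ i) (shiftedPart ν j))

/-- `τ(n, t, t') = ∑ det (G_{h_k h'_m}) s_μ(t) s_ν(t')` for all `n ≥ 0`, the sum being over
partitions `μ, ν` of length at most `n`, with one semi-infinite matrix `G` for all `n`. -/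
def HasTakasakiForm (τ : ℕ → MvPowerSeries Time ℂ) (G : ℕ → ℕ → ℂ) : Prop :=
  ∀ n : ℕ, HasSum
    (fun p : PartitionLE n × PartitionLE n =>
      MvPowerSeries.C (coeffDet G p.1 p.2) * schurLeft p.1.1 * schurRight p.2.1)
    (τ n)

/-! ## Tau functions of the Toda lattice hierarchy

The hierarchy is expressed by its bilinear residue identities, in the variables
`t, t'` (`Sum.inl`) and `s, s'` (`Sum.inr`) and an expansion variable `u` (`none`). -/

/-- The variables `t, t', s, s'`. -/
abbrev Time2 : Type := Time ⊕ Time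

/-- `f(x + ε [u], x' + ε' [u])`, where `[u] = (u, u^2/2, u^3/3, …)` and `x, x'` are
the variables `t, t'` or `s, s'` as chosen by `ι`. -/
def miwaShift (ι : Time → Time2) (ε ε' : ℂ) (f : MvPowerSeries Time ℂ) :
    MvPowerSeries (Option Time2) ℂ :=
  f.subst (fun v : Time =>
    (MvPowerSeries.X (some (ι v)) : MvPowerSeries (Option Time2) ℂ) +
      Sum.elim
        (fun m : ℕ+ => MvPowerSeries.C (ε / ((m : ℕ) : ℂ)) * MvPowerSeries.X none ^ (m : ℕ))
        (fun m : ℕ+ => MvPowerSeries.C (ε' / ((m : ℕ) : ℂ)) * MvPowerSeries.X none ^ (m : ℕ)) v)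

/-- The coefficient of `u ^ k` (zero for `k < 0`). -/
def uCoeff (k : ℤ) (P : MvPowerSeries (Option Time2) ℂ) : MvPowerSeries Time2 ℂ :=
  fun d => if 0 ≤ k then MvPowerSeries.coeff (d.optionElim k.toNat) P else 0

/-- The residue (coefficient of `z ^ {-1}`) of `z ^ r · P(u = z⁻¹) · e ^ {ξ(a, z)}`, where
`e ^ {ξ(a, z)} = ∑_c h_c(a) z ^ c`; for each monomial in `t, t', s, s'` only finitely many `c`
contribute when the `a_m` are linear combinations of the variables of index `m`. -/
def residue (r : ℤ) (P : MvPowerSeries (Option Time2) ℂ) (a : ℕ+ → MvPolynomial Time2 ℂ) :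
    MvPowerSeries Time2 ℂ :=
  ∑' c : ℕ, uCoeff ((c : ℤ) + r + 1) P *
    (MvPolynomial.aeval a (elemSchur (c : ℤ)) : MvPolynomial Time2 ℂ)

/-- `τ(n, t, t')`, `n ∈ ℤ`, is a tau function of the two-dimensional Toda lattice hierarchy: for
all integers `n, m` and all `t, t', s, s'`
`Res z^{n-m-1} τ(n, t - [z⁻¹], t') τ(m+1, s + [z⁻¹], s') e^{ξ(t - s, z)} dz`
`= Res z^{m-n-1} τ(n+1, t, t' + [z⁻¹]) τ(m, s, s' - [z⁻¹]) e^{ξ(s' - t', z)} dz`.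
The signs are those for which `φ_n = log (τ(n+1) / τ(n))` satisfies
`∂_{t₁} ∂_{t'₁} φ_n = e^{φ_{n+1} - φ_n} - e^{φ_n - φ_{n-1}}`. -/
def IsTodaTau (τ : ℤ → MvPowerSeries Time ℂ) : Prop :=
  ∀ n m : ℤ,
    residue (n - m - 1)
        (miwaShift Sum.inl (-1) 0 (τ n) * miwaShift Sum.inr 1 0 (τ (m + 1)))
        (fun k => MvPolynomial.X (Sum.inl (Sum.inl k)) - MvPolynomial.X (Sum.inr (Sum.inl k))) =
      residue (m - n - 1)
        (miwaShift Sum.inl 0 1 (τ (n + 1)) * miwaShift Sum.inr 0 (-1) (τ m))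
        (fun k => MvPolynomial.X (Sum.inr (Sum.inr k)) - MvPolynomial.X (Sum.inl (Sum.inr k)))

/-- The extension by zero to negative `n`. -/
def extendByZero (τ : ℕ → MvPowerSeries Time ℂ) (n : ℤ) : MvPowerSeries Time ℂ :=
  if 0 ≤ n then τ n.toNat else 0

/-- A tau function of the semi-infinite Toda lattice hierarchy. -/
def IsSemiInfiniteTodaTau (τ : ℕ → MvPowerSeries Time ℂ) : Prop :=
  IsTodaTau (extendByZero τ)

end

end DiscreteToda

/-! Let `U(t)` be the Toeplitz matrix with entries `h_{k-i}(t)`. Everything passes through the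
principal minors `momentDet` of `U(t) G U(t')ᵀ`, whose entries are the sums of `G_{i+a,j+b} h_a(t)
h_b(t')`.

The partition function is such a minor (`partitionFn_eq_momentDet`). The monomial `d` has
coefficient `x^a y^b / d!` in `e^{ξ(t,x)+ξ(t',y)}`, with `a`, `b` its weights in `t`, `t'`. Hence
summing over a single pair `(h, h')` yields an entry, and convergence of each coefficient is
convergence of a bimoment. Expanding both Vandermonde determinants factors the `2n`-fold sum into
products of `n` entries (Andréief's identity), and the factor `n!` cancels.

The Takasaki form (`hasTakasakiForm_momentDet`) is the Cauchy–Binet expansion of this minor; by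
Jacobi–Trudi the minors of the first `n` rows of `U(t)` are the Schur functions.

The bilinear identities (`isSemiInfiniteTodaTau_momentDet`) hold for every `G`. As `exp (∑ u^m z^m /
m) = 1 / (1 - u z)`, the shift `t - [u]` replaces row `i` by row `i` minus `u` times row `i + 1`,
and `t + [u]` replaces it by the sum of `u^c` times row `i + c`. The shifted determinants therefore
expand in minors with one row deleted (`det_sub_X_mul`) or with the last row moved down
(`coeff_det_mk`). Summation against `h_c(t - s)` uses `U(t - s) U(s) = U(t)` and turns the moved row
of the `(s, s')` matrix into a row of the mixed matrix `U(t) G U(s')ᵀ`. The left side becomes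
`bilinearSum`, a signed sum of minor times mixed entry times minor; the right side is the transposed
computation and gives the same sum. -/

namespace DiscreteToda

/-! ## Generating series of the elementary Schur polynomials -/

section ElementarySchur

variable {R : Type*} [CommRing R] [Algebra ℂ R]

/-- `∑_{k ≥ 0} h_k(a) z ^ k`. -/
noncomputable def schurGen (a : ℕ+ → R) : PowerSeries R :=
  PowerSeries.mk fun k => MvPolynomial.aeval a (elemSchurNat k)

/-- `∑_{m ≥ 0} (m + 1) a_{m + 1} z ^ m`. -/
noncomputable def logDeriv (a : ℕ+ → R) : PowerSeries R :=
  PowerSeries.mk fun k => ((k : R) + 1) * a k.succPNat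

lemma coeff_schurGen (a : ℕ+ → R) (k : ℕ) :
    PowerSeries.coeff k (schurGen a) = MvPolynomial.aeval a (elemSchurNat k) :=
  PowerSeries.coeff_mk _ _

/-- Puts the exponential over the ring of the substituted series, where the chain rule is applied.
-/
lemma subst_exp_eq {A : Type*} [CommRing A] [Algebra ℂ A] [Algebra ℚ A]
    {g : PowerSeries A} (hg : PowerSeries.HasSubst g) :
    (PowerSeries.exp ℂ).subst g = (PowerSeries.exp A).subst g := by
  ext n
  rw [PowerSeries.coeff_subst' hg, PowerSeries.coeff_subst' hg]
  refine finsum_congr fun d => ?_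
  rw [PowerSeries.coeff_exp, PowerSeries.coeff_exp, ← algebraMap_smul A (algebraMap ℚ ℂ _)]
  congr 1
  exact DFunLike.congr_fun (Subsingleton.elim ((algebraMap ℂ A).comp (algebraMap ℚ ℂ)) (algebraMap ℚ A)) _

lemma logDeriv_eq_derivative_mk :
    logDeriv (MvPolynomial.X : ℕ+ → MvPolynomial ℕ+ ℂ) =
      PowerSeries.derivative (MvPolynomial ℕ+ ℂ) (PowerSeries.mk fun m : ℕ =>
        if hm : 0 < m then (MvPolynomial.X ⟨m, hm⟩ : MvPolynomial ℕ+ ℂ) else 0) := by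
  ext1 n
  rw [PowerSeries.coeff_derivative, logDeriv, PowerSeries.coeff_mk, PowerSeries.coeff_mk,
    dif_pos n.succ_pos, mul_comm]
  rfl

lemma schurGen_X_eq :
    schurGen (MvPolynomial.X : ℕ+ → MvPolynomial ℕ+ ℂ) =
      (PowerSeries.exp ℂ).subst (PowerSeries.mk fun m : ℕ =>
        if hm : 0 < m then (MvPolynomial.X ⟨m, hm⟩ : MvPolynomial ℕ+ ℂ) else 0) := by
  ext1 n
  rw [coeff_schurGen, MvPolynomial.aeval_X_left, AlgHom.id_apply, elemSchurNat]

lemma derivative_schurGen_X :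
    PowerSeries.derivative (MvPolynomial ℕ+ ℂ) (schurGen (MvPolynomial.X : ℕ+ → MvPolynomial ℕ+ ℂ))
      = logDeriv MvPolynomial.X * schurGen MvPolynomial.X := by
  have hs : PowerSeries.HasSubst (PowerSeries.mk fun m : ℕ =>
        if hm : 0 < m then (MvPolynomial.X ⟨m, hm⟩ : MvPolynomial ℕ+ ℂ) else 0) :=
    PowerSeries.HasSubst.of_constantCoeff_zero' (by
      rw [← PowerSeries.coeff_zero_eq_constantCoeff_apply, PowerSeries.coeff_mk]; simp)
  rw [logDeriv_eq_derivative_mk, schurGen_X_eq, subst_exp_eq hs, PowerSeries.derivative_subst hs,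
    PowerSeries.derivative_exp, mul_comm]

lemma map_schurGen {S : Type*} [CommRing S] [Algebra ℂ S] (φ : R →ₐ[ℂ] S) (a : ℕ+ → R) :
    PowerSeries.map (φ : R →+* S) (schurGen a) = schurGen fun m => φ (a m) := by
  ext1 n
  rw [PowerSeries.coeff_map, coeff_schurGen, coeff_schurGen]
  exact (DFunLike.congr_fun (MvPolynomial.comp_aeval a φ) _)

lemma map_logDeriv {S : Type*} [CommRing S] [Algebra ℂ S] (φ : R →ₐ[ℂ] S) (a : ℕ+ → R) :
    PowerSeries.map (φ : R →+* S) (logDeriv a) = logDeriv fun m => φ (a m) := by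
  ext1 n
  simp [logDeriv, PowerSeries.coeff_map]

/-- Specialisation of the universal case along `aeval`. This differential equation, with constant
term `1`, characterises the generating series and replaces all further work with the exponential. -/
lemma derivative_schurGen (a : ℕ+ → R) :
    PowerSeries.derivative R (schurGen a) = logDeriv a * schurGen a := by
  have h := congrArg (PowerSeries.map (MvPolynomial.aeval (R := ℂ) a : MvPolynomial ℕ+ ℂ →+* R))
    derivative_schurGen_X
  rw [map_mul, map_logDeriv, map_schurGen] at h
  have h2 : PowerSeries.map (MvPolynomial.aeval (R := ℂ) a : MvPolynomial ℕ+ ℂ →+* R)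
      (PowerSeries.derivative _ (schurGen MvPolynomial.X)) =
      PowerSeries.derivative R (PowerSeries.map (MvPolynomial.aeval (R := ℂ) a : MvPolynomial ℕ+ ℂ →+* R)
        (schurGen MvPolynomial.X)) := by
    ext1 n
    simp [PowerSeries.coeff_derivative, PowerSeries.coeff_map]
  rw [h2, map_schurGen] at h
  simpa using h

lemma elemSchurNat_zero : elemSchurNat 0 = 1 := by
  rw [elemSchurNat, PowerSeries.coeff_zero_eq_constantCoeff_apply]
  have hs : PowerSeries.HasSubst (PowerSeries.mk fun m : ℕ =>
        if hm : 0 < m then (MvPolynomial.X ⟨m, hm⟩ : MvPolynomial ℕ+ ℂ) else 0) :=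
    PowerSeries.HasSubst.of_constantCoeff_zero' (by
      rw [← PowerSeries.coeff_zero_eq_constantCoeff_apply, PowerSeries.coeff_mk]; simp)
  rw [← PowerSeries.coeff_zero_eq_constantCoeff_apply, PowerSeries.coeff_subst' hs,
    finsum_eq_single _ 0]
  · simp
  · intro n hn
    rw [PowerSeries.coeff_zero_eq_constantCoeff_apply, map_pow,
      ← PowerSeries.coeff_zero_eq_constantCoeff_apply, PowerSeries.coeff_mk]
    simp [hn]

lemma constantCoeff_schurGen (a : ℕ+ → R) : PowerSeries.constantCoeff (schurGen a) = 1 := by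
  rw [← PowerSeries.coeff_zero_eq_constantCoeff_apply, coeff_schurGen, elemSchurNat_zero, map_one]

lemma natCast_mul_cancel {n : ℕ} {x y : R} (h : ((n : R) + 1) * x = ((n : R) + 1) * y) : x = y := by
  have hu : IsUnit ((n : R) + 1) := by
    have h1 : IsUnit ((n : ℂ) + 1) := (Nat.cast_add_one_ne_zero n).isUnit
    simpa using h1.map (algebraMap ℂ R)
  exact hu.mul_left_cancel h

/-- The equation expresses `n + 1` times coefficient `n + 1` through earlier coefficients, and `n +
1` is invertible in a `ℂ`-algebra. -/
lemma eq_of_logDeriv {F G P : PowerSeries R}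
    (hF : PowerSeries.derivative R F = P * F) (hG : PowerSeries.derivative R G = P * G)
    (h0 : PowerSeries.constantCoeff F = PowerSeries.constantCoeff G) : F = G := by
  ext1 n
  induction n using Nat.strong_induction_on with
  | _ n ih =>
    cases n with
    | zero => simpa using h0
    | succ n =>
      have h1 := congrArg (PowerSeries.coeff n) hF
      have h2 := congrArg (PowerSeries.coeff n) hG
      rw [PowerSeries.coeff_derivative, PowerSeries.coeff_mul] at h1 h2
      refine natCast_mul_cancel (n := n) ?_
      rw [mul_comm, h1, mul_comm ((n : R) + 1), h2]
      refine Finset.sum_congr rfl fun p hp => ?_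
      rw [ih p.2 (by have := Finset.HasAntidiagonal.mem_antidiagonal.mp hp; omega)]

lemma schurGen_eq {a : ℕ+ → R} {F : PowerSeries R}
    (hF : PowerSeries.derivative R F = logDeriv a * F) (h0 : PowerSeries.constantCoeff F = 1) :
    schurGen a = F :=
  eq_of_logDeriv (derivative_schurGen a) hF ((constantCoeff_schurGen a).trans h0.symm)

lemma schurGen_add (a b : ℕ+ → R) : schurGen (a + b) = schurGen a * schurGen b := by
  refine schurGen_eq ?_ (by rw [map_mul, constantCoeff_schurGen, constantCoeff_schurGen, one_mul])
  have h : logDeriv (a + b) = logDeriv a + logDeriv b := by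
    ext1 n
    simp only [logDeriv, PowerSeries.coeff_mk, map_add]
    exact mul_add _ _ _
  rw [h, Derivation.leibniz, derivative_schurGen, derivative_schurGen]
  simp only [smul_eq_mul]
  ring

lemma schurGen_zero : schurGen (0 : ℕ+ → R) = 1 := by
  refine schurGen_eq ?_ (map_one _)
  have h : logDeriv (0 : ℕ+ → R) = 0 := by
    ext1 n
    simp only [logDeriv, PowerSeries.coeff_mk, map_zero]
    exact mul_zero _
  rw [h, zero_mul, Derivation.map_one_eq_zero]

lemma natCast_mul_algebraMap_inv (n : ℕ) :
    ((n : R) + 1) * algebraMap ℂ R (1 / ((n : ℂ) + 1)) = 1 := by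
  have h : ((n : R) + 1) = algebraMap ℂ R ((n : ℂ) + 1) := by simp
  rw [h, ← map_mul, mul_one_div_cancel (Nat.cast_add_one_ne_zero n), map_one]

/-- This is `exp (∑ u^m z^m / m) = 1 / (1 - u z)`: in the differential equation each of the `n + 1`
products of coefficients equals `u^{n+1}`. -/
lemma schurGen_geom (u : R) :
    schurGen (fun m : ℕ+ => algebraMap ℂ R (1 / ((m : ℕ) : ℂ)) * u ^ (m : ℕ)) =
      PowerSeries.mk fun k => u ^ k := by
  refine schurGen_eq ?_ (by rw [← PowerSeries.coeff_zero_eq_constantCoeff_apply]; simp)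
  ext1 n
  rw [PowerSeries.coeff_derivative, PowerSeries.coeff_mul, PowerSeries.coeff_mk]
  rw [Finset.sum_congr rfl (g := fun _ => u ^ (n + 1))]
  · simp [Finset.Nat.card_antidiagonal, mul_comm]
  · rintro ⟨i, j⟩ hp
    rw [Finset.HasAntidiagonal.mem_antidiagonal] at hp
    simp only [logDeriv, PowerSeries.coeff_mk, Nat.succPNat_coe, Nat.succ_eq_add_one, Nat.cast_add,
      Nat.cast_one]
    rw [← mul_assoc, natCast_mul_algebraMap_inv, one_mul, ← pow_add]
    congr 1
    simp only at hp
    omega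

lemma schurGen_geom_neg (u : R) :
    schurGen (fun m : ℕ+ => algebraMap ℂ R (-1 / ((m : ℕ) : ℂ)) * u ^ (m : ℕ)) =
      1 - PowerSeries.C u * PowerSeries.X := by
  set a : ℕ+ → R := fun m => algebraMap ℂ R (1 / ((m : ℕ) : ℂ)) * u ^ (m : ℕ) with ha
  set b : ℕ+ → R := fun m => algebraMap ℂ R (-1 / ((m : ℕ) : ℂ)) * u ^ (m : ℕ) with hb
  have hab : schurGen b * schurGen a = 1 := by
    rw [← schurGen_add, ← schurGen_zero]
    congr 1
    ext m
    simp [ha, hb, neg_div]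
  have h1 : schurGen a * (1 - PowerSeries.C u * PowerSeries.X) = 1 := by
    rw [ha, schurGen_geom]
    ext1 n
    cases n with
    | zero => simp
    | succ n =>
      rw [mul_sub, mul_one, map_sub, ← mul_assoc, PowerSeries.coeff_succ_mul_X,
        PowerSeries.coeff_mul_C]
      simp [PowerSeries.coeff_one, pow_succ]
  calc schurGen b = schurGen b * (schurGen a * (1 - PowerSeries.C u * PowerSeries.X)) := by
        rw [h1, mul_one]
    _ = _ := by rw [← mul_assoc, hab, one_mul]

lemma aeval_elemSchurNat_add (a b : ℕ+ → R) (k : ℕ) :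
    MvPolynomial.aeval (fun m => a m + b m) (elemSchurNat k) =
      ∑ p ∈ Finset.HasAntidiagonal.antidiagonal k, MvPolynomial.aeval a (elemSchurNat p.1) *
        MvPolynomial.aeval b (elemSchurNat p.2) := by
  have h := congrArg (PowerSeries.coeff k) (schurGen_add a b)
  rw [PowerSeries.coeff_mul, coeff_schurGen] at h
  simpa only [coeff_schurGen] using! h

lemma aeval_elemSchurNat_succ (a : ℕ+ → R) (k : ℕ) :
    ((k : R) + 1) * MvPolynomial.aeval a (elemSchurNat (k + 1)) =
      ∑ p ∈ Finset.HasAntidiagonal.antidiagonal k, ((p.1 : R) + 1) * a p.1.succPNat *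
        MvPolynomial.aeval a (elemSchurNat p.2) := by
  have h := congrArg (PowerSeries.coeff k) (derivative_schurGen a)
  rw [PowerSeries.coeff_derivative, PowerSeries.coeff_mul, coeff_schurGen, mul_comm] at h
  simpa only [coeff_schurGen, logDeriv, PowerSeries.coeff_mk] using h

end ElementarySchur

/-- Induction through the Newton-type recurrence `aeval_elemSchurNat_succ`. The factor `c` allows `c
= 0`, for a weight that ignores the variables concerned. -/
lemma isWeightedHomogeneous_aeval_elemSchurNat {σ : Type*} (w : σ → ℕ)
    (c : ℕ) (a : ℕ+ → MvPolynomial σ ℂ) (ha : ∀ m, (a m).IsWeightedHomogeneous w (c * m)) (k : ℕ) :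
    (MvPolynomial.aeval a (elemSchurNat k)).IsWeightedHomogeneous w (c * k) := by
  induction k using Nat.strong_induction_on with
  | _ k ih =>
    cases k with
    | zero =>
      rw [elemSchurNat_zero, map_one, mul_zero]
      exact MvPolynomial.isWeightedHomogeneous_one _ _
    | succ k =>
      have h := aeval_elemSchurNat_succ a k
      have hC : ((k : MvPolynomial σ ℂ) + 1) = MvPolynomial.C ((k : ℂ) + 1) := by simp
      have h2 : MvPolynomial.aeval a (elemSchurNat (k + 1)) = MvPolynomial.C (((k : ℂ) + 1)⁻¹) *
          (((k : MvPolynomial σ ℂ) + 1) * MvPolynomial.aeval a (elemSchurNat (k + 1))) := by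
        rw [hC, ← mul_assoc, ← map_mul, inv_mul_cancel₀ (Nat.cast_add_one_ne_zero k), map_one,
          one_mul]
      rw [h2, h]
      have hC0 := fun c : ℂ => MvPolynomial.isWeightedHomogeneous_C w c
      rw [← zero_add (c * (k + 1))]
      refine (hC0 _).mul (MvPolynomial.IsWeightedHomogeneous.sum _ _ _ fun p hp => ?_)
      have hp' := Finset.HasAntidiagonal.mem_antidiagonal.mp hp
      have e : c * (k + 1) = 0 + c * (p.1 + 1) + c * p.2 := by rw [← hp']; ring
      rw [e]
      refine ((?_ : MvPolynomial.IsWeightedHomogeneous w _ 0).mul (ha _)).mul (ih _ (by omega))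
      have : ((p.1 : MvPolynomial σ ℂ) + 1) = MvPolynomial.C ((p.1 : ℂ) + 1) := by simp
      rw [this]
      exact hC0 _

/-! ## Locally finite families of power series -/

section LocallyFinite

variable {σ ι κ : Type*}

/-- A family of power series in which each coefficient vanishes for almost all members. -/
def LocFinite (f : ι → MvPowerSeries σ ℂ) : Prop :=
  ∀ d : σ →₀ ℕ, {i | MvPowerSeries.coeff d (f i) ≠ 0}.Finite

lemma LocFinite.summable {f : ι → MvPowerSeries σ ℂ} (hf : LocFinite f) : Summable f :=
  MvPowerSeries.WithPiTopology.summable_iff_summable_coeff.mpr fun d =>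
    summable_of_hasFiniteSupport (hf d)

lemma LocFinite.mul {f : ι → MvPowerSeries σ ℂ} {g : κ → MvPowerSeries σ ℂ}
    (hf : LocFinite f) (hg : LocFinite g) :
    LocFinite fun p : ι × κ => f p.1 * g p.2 := by
  classical
  intro d
  refine Set.Finite.subset (Set.Finite.biUnion
    (Finset.HasAntidiagonal.antidiagonal d).finite_toSet
    fun e _ => (hf e.1).prod (hg e.2)) ?_
  rintro ⟨i, j⟩ hij
  rw [Set.mem_ofPred_eq, MvPowerSeries.coeff_mul] at hij
  obtain ⟨e, he, hne⟩ := Finset.exists_ne_zero_of_sum_ne_zero hij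
  exact Set.mem_biUnion (Finset.mem_coe.mpr he)
    ⟨left_ne_zero_of_mul hne, right_ne_zero_of_mul hne⟩

lemma LocFinite.C_mul {f : ι → MvPowerSeries σ ℂ} (hf : LocFinite f) (c : ι → ℂ) :
    LocFinite fun i => MvPowerSeries.C (c i) * f i := by
  intro d
  refine (hf d).subset fun i hi => ?_
  rw [Set.mem_ofPred_eq, MvPowerSeries.coeff_C_mul] at hi
  exact right_ne_zero_of_mul hi

end LocallyFinite

/-- `h_k(a)` as a power series. -/
noncomputable def schurSeries {σ : Type*} (a : ℕ+ → MvPolynomial σ ℂ) (k : ℕ) :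
    MvPowerSeries σ ℂ :=
  (MvPolynomial.aeval a (elemSchurNat k) : MvPolynomial σ ℂ)

/-- By homogeneity a monomial occurs only in the `h_k` whose index is its weight. -/
lemma locFinite_schurSeries {σ : Type*} (w : σ → ℕ) (a : ℕ+ → MvPolynomial σ ℂ)
    (ha : ∀ m, (a m).IsWeightedHomogeneous w m) : LocFinite (schurSeries a) := by
  intro d
  refine (Set.finite_singleton (Finsupp.weight w d)).subset fun k hk => ?_
  rw [Set.mem_ofPred_eq, schurSeries, MvPolynomial.coeff_coe] at hk
  exact ((isWeightedHomogeneous_aeval_elemSchurNat w 1 a (by simpa using ha) k hk).trans (one_mul k)).symm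

lemma schurSeries_add {σ : Type*} (a b : ℕ+ → MvPolynomial σ ℂ) (k : ℕ) :
    schurSeries (fun m => a m + b m) k = ∑ p ∈ Finset.HasAntidiagonal.antidiagonal k,
      schurSeries a p.1 * schurSeries b p.2 := by
  rw [schurSeries, aeval_elemSchurNat_add]
  simp only [schurSeries, ← MvPolynomial.coeToMvPowerSeries.ringHom_apply, map_sum, map_mul]

/-! ## Coefficients of the exponential of a linear form -/

/-- `∏ 1 / d_v!`. -/
noncomputable def invFactorial {σ : Type*} (d : σ →₀ ℕ) : ℂ :=
  d.prod fun _ n => ((n.factorial : ℂ))⁻¹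

lemma invFactorial_zero {σ : Type*} : invFactorial (0 : σ →₀ ℕ) = 1 :=
  Finsupp.prod_zero_index

lemma invFactorial_add_single {σ : Type*} (d : σ →₀ ℕ) (v : σ) :
    invFactorial (d + Finsupp.single v 1) * ((d v : ℂ) + 1) = invFactorial d := by
  classical
  have h1 : ∀ e : σ →₀ ℕ, e.support ⊆ insert v d.support →
      invFactorial e = ((e v).factorial : ℂ)⁻¹ *
        ∏ u ∈ d.support.erase v, ((e u).factorial : ℂ)⁻¹ := by
    intro e he
    rw [invFactorial, Finsupp.prod_of_support_subset e he _ (by simp),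
      ← Finset.mul_prod_erase _ _ (Finset.mem_insert_self v _), Finset.erase_insert_eq_erase]
  have h2 : (d + Finsupp.single v 1).support ⊆ insert v d.support := by
    intro u hu
    by_cases h : u = v
    · simp [h]
    · rw [Finsupp.mem_support_iff, Finsupp.add_apply, Finsupp.single_apply, if_neg (Ne.symm h)] at hu
      simpa [h] using hu
  rw [h1 _ h2, h1 d (Finset.subset_insert _ _)]
  rw [Finset.prod_congr rfl (g := fun u => ((d u).factorial : ℂ)⁻¹)]
  · have : ((d v : ℂ) + 1) ≠ 0 := Nat.cast_add_one_ne_zero _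
    rw [Finsupp.add_apply, Finsupp.single_eq_same, Nat.factorial_succ, Nat.cast_mul,
      Nat.cast_add_one]
    field_simp
  · intro u hu
    rw [Finsupp.add_apply, Finsupp.single_apply, if_neg (Finset.ne_of_mem_erase hu).symm, add_zero]

lemma invFactorial_of_mem {σ : Type*} (d : σ →₀ ℕ) (v : σ) (hv : v ∈ d.support) :
    invFactorial (d - Finsupp.single v 1) = d v * invFactorial d := by
  have h := invFactorial_add_single (d - Finsupp.single v 1) v
  have h1 : 1 ≤ d v := Nat.one_le_iff_ne_zero.mpr (Finsupp.mem_support_iff.mp hv)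
  rw [tsub_add_cancel_of_le (Finsupp.single_le_iff.mpr h1)] at h
  rw [← h, Finsupp.tsub_apply, Finsupp.single_eq_same, Nat.cast_sub h1]
  push_cast
  ring

/-- The degree of a monomial in `t`, with `t_m` of weight `m`. -/
noncomputable def weightLeft (d : Time →₀ ℕ) : ℕ :=
  Finsupp.weight (Sum.elim (fun m : ℕ+ => (m : ℕ)) fun _ => 0) d

/-- The degree of a monomial in `t'`, with `t'_m` of weight `m`. -/
noncomputable def weightRight (d : Time →₀ ℕ) : ℕ :=
  Finsupp.weight (Sum.elim (fun _ => 0) fun m : ℕ+ => (m : ℕ)) d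

lemma locFinite_C_mul_X {e : ℕ+ → Time} (he : Function.Injective e) (c : ℕ+ → ℂ) :
    LocFinite fun m : ℕ+ =>
      MvPowerSeries.C (c m) * (MvPowerSeries.X (e m) : MvPowerSeries Time ℂ) := by
  classical
    refine LocFinite.C_mul (fun d => Set.Subsingleton.finite fun m hm n hn => ?_) c
    simp only [Set.mem_ofPred_eq, MvPowerSeries.coeff_X, ne_eq, ite_eq_right_iff, one_ne_zero,
      imp_false, not_not] at hm hn
    exact he (Finsupp.single_left_injective one_ne_zero (hm.symm.trans hn))

lemma coeff_add_single_xi {e : ℕ+ → Time} (he : Function.Injective e) (c : ℕ+ → ℂ)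
    (d : Time →₀ ℕ) (v : Time) :
    MvPowerSeries.coeff (d + Finsupp.single v 1)
        (∑' m : ℕ+, MvPowerSeries.C (c m) * MvPowerSeries.X (e m)) =
      ∑' m : ℕ+, if d = 0 ∧ v = e m then c m else 0 := by
  classical
  rw [(locFinite_C_mul_X he c).summable.map_tsum (MvPowerSeries.coeff (d + Finsupp.single v 1))
    (MvPowerSeries.WithPiTopology.continuous_coeff ℂ _)]
  refine tsum_congr fun m => ?_
  rw [MvPowerSeries.coeff_C_mul, MvPowerSeries.coeff_X]
  have : d + Finsupp.single v 1 = Finsupp.single (e m) 1 ↔ d = 0 ∧ v = e m := by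
    constructor
    · intro h
      have hv : v = e m := by
        by_contra hne
        have := DFunLike.congr_fun h v
        rw [Finsupp.add_apply, Finsupp.single_eq_same, Finsupp.single_apply,
          if_neg (Ne.symm hne)] at this
        omega
      exact ⟨by rwa [hv, add_eq_right] at h, hv⟩
    · rintro ⟨rfl, rfl⟩
      simp
  simp only [this, mul_ite, mul_one, mul_zero]

lemma pderiv_xiSum (x y : ℂ) (v : Time) :
    MvPowerSeries.pderiv ℂ v (xiSum x y) =
      MvPowerSeries.C (Sum.elim (fun m : ℕ+ => x ^ (m : ℕ)) (fun m : ℕ+ => y ^ (m : ℕ)) v) := by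
  classical
  ext d
  rw [MvPowerSeries.coeff_pderiv, xiSum, map_add,
    coeff_add_single_xi Sum.inl_injective, coeff_add_single_xi Sum.inr_injective,
    MvPowerSeries.coeff_C]
  by_cases hd : d = 0
  · subst hd
    cases v with
    | inl k => simp
    | inr k => simp
  · simp [hd]

lemma constantCoeff_xiSum (x y : ℂ) : MvPowerSeries.constantCoeff (xiSum x y) = 0 := by
  classical
  have hs : ∀ (e : ℕ+ → Time) (_ : Function.Injective e) (c : ℕ+ → ℂ),
      MvPowerSeries.constantCoeff (∑' m : ℕ+, MvPowerSeries.C (c m) *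
        (MvPowerSeries.X (e m) : MvPowerSeries Time ℂ)) = 0 := by
    intro e he c
    rw [(locFinite_C_mul_X he c).summable.map_tsum _ (MvPowerSeries.WithPiTopology.continuous_constantCoeff ℂ)]
    simp
  rw [xiSum, map_add, hs _ Sum.inl_injective, hs _ Sum.inr_injective, add_zero]

/-- The coefficient of the monomial `d` in `e ^ {ξ(t, x) + ξ(t', y)}`. -/
noncomputable def expXiCoeff (x y : ℂ) (d : Time →₀ ℕ) : ℂ :=
  invFactorial d * (x ^ weightLeft d * y ^ weightRight d)

lemma expXiCoeff_add_single (x y : ℂ) (d : Time →₀ ℕ) (v : Time) :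
    expXiCoeff x y (d + Finsupp.single v 1) * ((d v : ℂ) + 1) =
      Sum.elim (fun m : ℕ+ => x ^ (m : ℕ)) (fun m : ℕ+ => y ^ (m : ℕ)) v * expXiCoeff x y d := by
  rw [expXiCoeff, expXiCoeff, ← invFactorial_add_single d v, weightLeft, weightRight, map_add,
    map_add, weightLeft, weightRight]
  cases v <;> simp [Finsupp.weight_single, pow_add] <;> ring

/-- The multinomial formula in infinitely many variables, by induction on `n`: differentiating in a
variable that divides the monomial lowers the power, because the derivative of a linear form is
constant. -/
lemma coeff_xiSum_pow (x y : ℂ) (n : ℕ) (d : Time →₀ ℕ) :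
    MvPowerSeries.coeff d (xiSum x y ^ n) =
      if d.degree = n then (n.factorial : ℂ) * expXiCoeff x y d else 0 := by
  classical
  induction n generalizing d with
  | zero =>
    rw [pow_zero, MvPowerSeries.coeff_one]
    simp only [Finsupp.degree_eq_zero_iff]
    split_ifs with h
    · subst h
      simp [expXiCoeff, invFactorial_zero, weightLeft, weightRight]
    · rfl
  | succ n ih =>
    by_cases hd : d = 0
    · subst hd
      rw [MvPowerSeries.coeff_zero_eq_constantCoeff_apply, map_pow, constantCoeff_xiSum]
      simp
    · obtain ⟨v, hv⟩ := Finsupp.support_nonempty_iff.mpr hd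
      have h1 : 1 ≤ d v := Nat.one_le_iff_ne_zero.mpr (Finsupp.mem_support_iff.mp hv)
      obtain ⟨e, rfl⟩ : ∃ e, d = e + Finsupp.single v 1 :=
        ⟨d - Finsupp.single v 1, (tsub_add_cancel_of_le (Finsupp.single_le_iff.mpr h1)).symm⟩
      have hne : ((e v : ℂ) + 1) ≠ 0 := Nat.cast_add_one_ne_zero _
      refine mul_right_cancel₀ hne ?_
      rw [← MvPowerSeries.coeff_pderiv, MvPowerSeries.pderiv_pow, pderiv_xiSum,
        MvPowerSeries.coeff_mul_C, Nat.add_sub_cancel, ite_mul, mul_assoc, expXiCoeff_add_single,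
        zero_mul]
      have hc : ((n + 1 : ℕ) : MvPowerSeries Time ℂ) = MvPowerSeries.C ((n + 1 : ℕ) : ℂ) := by simp
      rw [hc, MvPowerSeries.coeff_C_mul, ih, map_add, Finsupp.degree_single]
      simp only [add_left_inj, Nat.factorial_succ]
      split_ifs
      · push_cast; ring
      · simp

lemma coeff_expXi (x y : ℂ) (d : Time →₀ ℕ) :
    MvPowerSeries.coeff d (expXi x y) = expXiCoeff x y d := by
  rw [expXi, PowerSeries.coeff_subst
    (PowerSeries.HasSubst.of_constantCoeff_zero (constantCoeff_xiSum x y)),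
    finsum_eq_single _ d.degree]
  · rw [coeff_xiSum_pow, if_pos rfl, PowerSeries.coeff_exp]
    simp [Nat.factorial_ne_zero]
  · intro n hn
    rw [coeff_xiSum_pow, if_neg hn.symm, smul_zero]

/-! ## Coefficients of `h_a(t) h_b(t')` -/

/-- In the recurrence for `h_{k+1}`, removing a variable `v` from `d` multiplies `1 / d!` by `d_v`;
the resulting factors `d_v w_v` add up to the weight `k + 1`. -/
lemma coeff_aeval_elemSchurNat_both (k : ℕ) (d : Time →₀ ℕ)
    (hd : Finsupp.weight (Sum.elim (fun m : ℕ+ => (m : ℕ)) fun m : ℕ+ => (m : ℕ)) d = k) :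
    MvPolynomial.coeff d (MvPolynomial.aeval (fun m : ℕ+ =>
      (MvPolynomial.X (Sum.inl m) + MvPolynomial.X (Sum.inr m) : MvPolynomial Time ℂ))
        (elemSchurNat k)) = invFactorial d := by
  classical
  set w : Time → ℕ := Sum.elim (fun m : ℕ+ => (m : ℕ)) fun m : ℕ+ => (m : ℕ) with hw
  have hwne : ∀ v, w v ≠ 0 := by rintro (m | m) <;> simp [hw]
  set a : ℕ+ → MvPolynomial Time ℂ := fun m =>
    MvPolynomial.X (Sum.inl m) + MvPolynomial.X (Sum.inr m) with ha
  induction k using Nat.strong_induction_on generalizing d with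
  | _ k ih =>
    cases k with
    | zero =>
      have : d = 0 := by
        rw [← Finsupp.support_eq_empty, Finset.eq_empty_iff_forall_notMem]
        intro v hv
        have := Finsupp.le_weight w (hwne v) d (s := v)
        rw [hd] at this
        exact (Finsupp.mem_support_iff.mp hv) (by omega)
      subst this
      rw [elemSchurNat_zero, map_one, invFactorial_zero, MvPolynomial.coeff_zero_one]
    | succ k =>
      have h := congrArg (MvPolynomial.coeff d) (aeval_elemSchurNat_succ a k)
      have hcast : ∀ n : ℕ, ((n : MvPolynomial Time ℂ) + 1) = MvPolynomial.C ((n : ℂ) + 1) := by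
        intro n; simp
      rw [hcast, MvPolynomial.coeff_C_mul, MvPolynomial.coeff_sum] at h
      refine mul_left_cancel₀ (Nat.cast_add_one_ne_zero k : (k : ℂ) + 1 ≠ 0) (h.trans ?_)
      have hX : ∀ (v : Time) (j : ℕ), w v + j = k + 1 → j < k + 1 →
          MvPolynomial.coeff d (MvPolynomial.X v * MvPolynomial.aeval a (elemSchurNat j)) =
            d v * invFactorial d := by
        intro v j hj hjk
        rw [MvPolynomial.coeff_X_mul']
        split_ifs with hv
        · rw [ih j hjk, invFactorial_of_mem d v hv]
          have h1 : 1 ≤ d v := Nat.one_le_iff_ne_zero.mpr (Finsupp.mem_support_iff.mp hv)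
          have h2 := congrArg (Finsupp.weight w)
            (tsub_add_cancel_of_le (Finsupp.single_le_iff.mpr h1) :
              d - Finsupp.single v 1 + Finsupp.single v 1 = d)
          rw [map_add, hd, Finsupp.weight_single, one_smul] at h2
          omega
        · rw [Finsupp.notMem_support_iff.mp hv, Nat.cast_zero, zero_mul]
      have hterm : ∀ p ∈ Finset.HasAntidiagonal.antidiagonal k,
          MvPolynomial.coeff d (((p.1 : MvPolynomial Time ℂ) + 1) * a p.1.succPNat *
            MvPolynomial.aeval a (elemSchurNat p.2)) =
          (((p.1 : ℂ) + 1) * (d (Sum.inl (Nat.succPNat p.1)) + d (Sum.inr (Nat.succPNat p.1)))) *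
            invFactorial d := by
        intro p hp
        have hp' := Finset.HasAntidiagonal.mem_antidiagonal.mp hp
        have hap : a p.1.succPNat = MvPolynomial.X (Sum.inl p.1.succPNat) +
          MvPolynomial.X (Sum.inr p.1.succPNat) := rfl
        rw [hcast, mul_assoc, MvPolynomial.coeff_C_mul, hap, add_mul (MvPolynomial.X _),
          MvPolynomial.coeff_add,
          hX _ _ ?_ (by omega), hX _ _ ?_ (by omega)]
        · ring
        · simp only [hw, Sum.elim_inr, Nat.succPNat_coe]; omega
        · simp only [hw, Sum.elim_inl, Nat.succPNat_coe]; omega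
      rw [Finset.sum_congr rfl hterm, ← Finset.sum_mul,
        Finset.Nat.sum_antidiagonal_eq_sum_range_succ_mk]
      congr 1
      -- Variables of `d` have index at most `k + 1`, so the sum in the recurrence meets all of
      -- them.
      have hsub : d.support ⊆ ((Finset.range (k + 1)).map
          ⟨Nat.succPNat, Nat.succPNat_injective⟩).disjSum
          ((Finset.range (k + 1)).map ⟨Nat.succPNat, Nat.succPNat_injective⟩) := by
        intro v hv
        have hvw : w v ≤ k + 1 := by
          rw [← hd, Finsupp.weight_apply]
          have := Finset.single_le_sum (f := fun u => d u • w u) (fun _ _ => Nat.zero_le _) hv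
          refine le_trans ?_ this
          have h1 : 1 ≤ d v := Nat.one_le_iff_ne_zero.mpr (Finsupp.mem_support_iff.mp hv)
          simpa using Nat.mul_le_mul_right (w v) h1
        cases v with
        | inl m =>
          rw [Finset.inl_mem_disjSum, Finset.mem_map]
          exact ⟨m.natPred, by simp [hw] at hvw ⊢; have := m.pos; unfold PNat.natPred; omega, by simp⟩
        | inr m =>
          rw [Finset.inr_mem_disjSum, Finset.mem_map]
          exact ⟨m.natPred, by simp [hw] at hvw ⊢; have := m.pos; unfold PNat.natPred; omega, by simp⟩
      have hk : (k : ℂ) + 1 = ((Finsupp.weight w d : ℕ) : ℂ) := by rw [hd]; push_cast; rfl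
      rw [hk, Finsupp.weight_apply, Finsupp.sum_of_support_subset d hsub _ (by simp),
        Finset.sum_disjSum, Finset.sum_map, Finset.sum_map, ← Finset.sum_add_distrib, Nat.cast_sum]
      refine Finset.sum_congr rfl fun i _ => ?_
      simp [hw]
      ring

/-- `h_k(t)`. -/
noncomputable def elemLeft : ℕ → MvPowerSeries Time ℂ :=
  schurSeries fun m => MvPolynomial.X (Sum.inl m)

/-- `h_k(t')`. -/
noncomputable def elemRight : ℕ → MvPowerSeries Time ℂ :=
  schurSeries fun m => MvPolynomial.X (Sum.inr m)

/-- The two weights of `d` single out one term of `h_{a+b}(t + t') = ∑ h_i(t) h_j(t')`. -/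
lemma coeff_elemLeft_mul_elemRight (a b : ℕ) (d : Time →₀ ℕ) :
    MvPowerSeries.coeff d (elemLeft a * elemRight b) =
      if weightLeft d = a ∧ weightRight d = b then invFactorial d else 0 := by
  have key : ∀ a b : ℕ, MvPowerSeries.coeff d (elemLeft a * elemRight b) ≠ 0 →
      weightLeft d = a ∧ weightRight d = b := by
    intro a b hne
    rw [elemLeft, elemRight, schurSeries, schurSeries, ← MvPolynomial.coe_mul,
      MvPolynomial.coeff_coe] at hne
    have h0 : ∀ (w : Time → ℕ) (e : ℕ+ → Time) (c : ℕ) (_ : ∀ m, w (e m) = c * m) (k : ℕ),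
        (MvPolynomial.aeval (fun m => (MvPolynomial.X (e m) : MvPolynomial Time ℂ))
          (elemSchurNat k)).IsWeightedHomogeneous w (c * k) := fun w e c hwe k =>
      isWeightedHomogeneous_aeval_elemSchurNat w c _
        (fun m => by rw [← hwe]; exact MvPolynomial.isWeightedHomogeneous_X ℂ _ _) k
    have h1 := ((h0 (Sum.elim (fun m : ℕ+ => (m : ℕ)) fun _ => 0) Sum.inl 1 (by simp) a).mul
      (h0 (Sum.elim (fun m : ℕ+ => (m : ℕ)) fun _ => 0) Sum.inr 0 (by simp) b)) hne
    have h2 := ((h0 (Sum.elim (fun _ => 0) (fun m : ℕ+ => (m : ℕ))) Sum.inl 0 (by simp) a).mul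
      (h0 (Sum.elim (fun _ => 0) (fun m : ℕ+ => (m : ℕ))) Sum.inr 1 (by simp) b)) hne
    rw [one_mul, zero_mul] at h1 h2
    exact ⟨h1, h2.trans (zero_add b)⟩
  split_ifs with h
  · obtain ⟨rfl, rfl⟩ := h
    have hw : Finsupp.weight (Sum.elim (fun m : ℕ+ => (m : ℕ)) fun m : ℕ+ => (m : ℕ)) d =
        weightLeft d + weightRight d := by
      rw [weightLeft, weightRight, Finsupp.weight_apply, Finsupp.weight_apply,
        Finsupp.weight_apply, ← Finsupp.sum_add]
      refine Finsupp.sum_congr fun v _ => ?_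
      cases v <;> simp
    have h1 := coeff_aeval_elemSchurNat_both _ d hw
    rw [← h1, ← MvPolynomial.coeff_coe]
    have h2 := schurSeries_add (fun m => (MvPolynomial.X (Sum.inl m) : MvPolynomial Time ℂ))
      (fun m => MvPolynomial.X (Sum.inr m)) (weightLeft d + weightRight d)
    rw [schurSeries] at h2
    rw [h2, map_sum, Finset.sum_eq_single (weightLeft d, weightRight d)]
    · rfl
    · rintro ⟨i, j⟩ _ hne
      by_contra hne'
      obtain ⟨rfl, rfl⟩ := key i j hne'
      exact hne rfl
    · intro hn
      exact absurd (Finset.HasAntidiagonal.mem_antidiagonal (n := weightLeft d + weightRight d)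
        (a := (weightLeft d, weightRight d)) |>.mpr rfl) hn
  · by_contra hne
    exact h (key a b hne)

/-- Regularity is what summation fibre by fibre requires. -/
instance {σ : Type*} : T3Space (MvPowerSeries σ ℂ) :=
  inferInstanceAs (T3Space ((σ →₀ ℕ) → ℂ))

/-! ## The matrix `U(f) G U(g)ᵀ` with `U(f)_{ik} = f_{k - i}` -/

section MomentSum

variable {σ : Type*}

/-- `∑_{a, b ≥ 0} G_{i + a, j + b} f_a g_b`. -/
noncomputable def momentSum (G : ℕ → ℕ → ℂ) (f g : ℕ → MvPowerSeries σ ℂ) (i j : ℕ) :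
    MvPowerSeries σ ℂ :=
  ∑' p : ℕ × ℕ, MvPowerSeries.C (G (i + p.1) (j + p.2)) * (f p.1 * g p.2)

lemma hasSum_momentSum (G : ℕ → ℕ → ℂ) {f g : ℕ → MvPowerSeries σ ℂ} (hf : LocFinite f)
    (hg : LocFinite g) (i j : ℕ) :
    HasSum (fun p : ℕ × ℕ => MvPowerSeries.C (G (i + p.1) (j + p.2)) * (f p.1 * g p.2))
      (momentSum G f g i j) :=
  ((hf.mul hg).C_mul fun p => G (i + p.1) (j + p.2)).summable.hasSum

lemma momentSum_swap (G : ℕ → ℕ → ℂ) (f g : ℕ → MvPowerSeries σ ℂ) (i j : ℕ) :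
    momentSum G f g i j = momentSum (fun a b => G b a) g f j i := by
  rw [momentSum, momentSum, ← (Equiv.prodComm ℕ ℕ).tsum_eq]
  refine tsum_congr fun p => ?_
  simp [mul_comm]

/-- The product rule `U(e) U(f) = U(e * f)` with `*` the convolution: the triple sum over `(c, a,
b)` is regrouped by `k = c + a`. -/
lemma hasSum_mul_momentSum (G : ℕ → ℕ → ℂ) {e f g : ℕ → MvPowerSeries σ ℂ} (he : LocFinite e)
    (hf : LocFinite f) (hg : LocFinite g) (i j : ℕ) :
    HasSum (fun c => e c * momentSum G f g (c + i) j)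
      (momentSum G (fun k => ∑ p ∈ Finset.HasAntidiagonal.antidiagonal k, e p.1 * f p.2) g i j) := by
  set F : ℕ × ℕ × ℕ → MvPowerSeries σ ℂ := fun q =>
    MvPowerSeries.C (G (q.1 + i + q.2.1) (j + q.2.2)) * (e q.1 * (f q.2.1 * g q.2.2)) with hF
  have hs : Summable F := ((he.mul (hf.mul hg)).C_mul _).summable
  have h1 : HasSum (fun c => e c * momentSum G f g (c + i) j) (∑' q, F q) := by
    refine hs.hasSum.prod_fiberwise fun c => ?_
    refine ((hasSum_momentSum G hf hg (c + i) j).mul_left (e c)).congr_fun ?_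
    intro p
    simp only [hF]
    ring
  suffices h2 : ∑' q, F q = momentSum G
      (fun k => ∑ p ∈ Finset.HasAntidiagonal.antidiagonal k, e p.1 * f p.2) g i j by
    rwa [← h2]
  set E : (Σ p : ℕ × ℕ, Finset.HasAntidiagonal.antidiagonal p.1) ≃ ℕ × ℕ × ℕ :=
    { toFun := fun x => (x.2.1.1, x.2.1.2, x.1.2)
      invFun := fun q => ⟨(q.1 + q.2.1, q.2.2), ⟨(q.1, q.2.1),
        Finset.HasAntidiagonal.mem_antidiagonal.mpr rfl⟩⟩
      left_inv := by
        rintro ⟨⟨k, b⟩, ⟨⟨c, a⟩, h⟩⟩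
        have h' := Finset.HasAntidiagonal.mem_antidiagonal.mp h
        simp only at h'
        subst h'
        rfl
      right_inv := fun _ => rfl } with hE
  have h3 : HasSum (F ∘ E) (∑' q, F q) := E.hasSum_iff.mpr hs.hasSum
  refine (h3.sigma fun p => hasSum_fintype _).tsum_eq.symm.trans (tsum_congr fun p => ?_)
  simp only [Function.comp_apply, hE, hF, Equiv.coe_fn_mk]
  rw [Finset.sum_mul, Finset.mul_sum,
    ← Finset.sum_coe_sort (Finset.HasAntidiagonal.antidiagonal p.1)]
  refine Finset.sum_congr rfl fun x _ => ?_
  have h' := Finset.HasAntidiagonal.mem_antidiagonal.mp x.2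
  have e1 : x.1.1 + i + x.1.2 = i + p.1 := by omega
  rw [e1]
  ring

lemma map_momentSum {τ : Type*} (G : ℕ → ℕ → ℂ) {f g : ℕ → MvPowerSeries σ ℂ} (hf : LocFinite f)
    (hg : LocFinite g) (φ : MvPowerSeries σ ℂ →ₗ[ℂ] MvPowerSeries τ ℂ) (hφ : Continuous φ)
    (i j : ℕ) :
    HasSum (fun p : ℕ × ℕ => MvPowerSeries.C (G (i + p.1) (j + p.2)) * φ (f p.1 * g p.2))
      (φ (momentSum G f g i j)) := by
  have h := (hasSum_momentSum G hf hg i j).map φ hφ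
  refine h.congr_fun fun p => ?_
  simp only [Function.comp_apply]
  rw [← MvPowerSeries.smul_eq_C_mul, ← MvPowerSeries.smul_eq_C_mul, map_smul]

end MomentSum

/-! ## Substitutions -/

section Subst

variable {σ τ : Type*}

lemma continuous_subst_complex {a : σ → MvPowerSeries τ ℂ} (ha : MvPowerSeries.HasSubst a) :
    Continuous (MvPowerSeries.subst a : MvPowerSeries σ ℂ → MvPowerSeries τ ℂ) := by
  refine continuous_pi fun e => ?_
  -- The series with all coefficients `1` gives a finite set of exponents that serves every `f`, so
  -- each coefficient of the result is a fixed finite linear combination of coefficients of `f`.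
  set S := (MvPowerSeries.coeff_subst_finite ha
    ((fun _ => 1 : (σ →₀ ℕ) → ℂ) : MvPowerSeries σ ℂ) e).toFinset with hS
  have h : ∀ f : MvPowerSeries σ ℂ, MvPowerSeries.subst a f e =
      ∑ d ∈ S, MvPowerSeries.coeff d f * MvPowerSeries.coeff e (d.prod fun s n => a s ^ n) := by
    intro f
    refine (MvPowerSeries.coeff_subst ha f e).trans ?_
    rw [finsum_eq_sum_of_support_subset]
    · rfl
    · intro d hd
      refine Finset.mem_coe.mpr ((Set.Finite.mem_toFinset _).mpr ?_)
      rw [Function.mem_support] at hd ⊢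
      have h1 : MvPowerSeries.coeff d ((fun _ => 1 : (σ →₀ ℕ) → ℂ) : MvPowerSeries σ ℂ) = 1 := rfl
      rw [h1, one_smul]
      exact right_ne_zero_of_smul hd
  simp only [h]
  exact continuous_finsetSum _ fun d _ =>
    (MvPowerSeries.WithPiTopology.continuous_coeff ℂ d).mul continuous_const

lemma uCoeff_eq (n : ℕ) (P : MvPowerSeries (Option Time2) ℂ) :
    uCoeff n P = PowerSeries.coeff n (MvPowerSeries.optionEquivLeft Time2 ℂ P) := by
  ext d
  rw [MvPowerSeries.coeff_coeff_optionEquivLeft]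
  simp [uCoeff, MvPowerSeries.coeff_apply]

lemma uCoeff_of_neg {k : ℤ} (hk : k < 0) (P : MvPowerSeries (Option Time2) ℂ) :
    uCoeff k P = 0 := by
  funext d
  simp only [uCoeff, hk.not_ge, if_false]
  rfl

lemma continuous_coeff_optionEquivLeft (n : ℕ) :
    Continuous fun P : MvPowerSeries (Option σ) ℂ =>
      PowerSeries.coeff n (MvPowerSeries.optionEquivLeft σ ℂ P) := by
  refine continuous_pi fun d => ?_
  have h : ∀ P : MvPowerSeries (Option σ) ℂ,
      PowerSeries.coeff n (MvPowerSeries.optionEquivLeft σ ℂ P) d =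
        MvPowerSeries.coeff (d.optionElim n) P := fun P =>
    MvPowerSeries.coeff_coeff_optionEquivLeft P n d
  simp only [h]
  exact MvPowerSeries.WithPiTopology.continuous_coeff ℂ _

/-- The images of the variables under the shift by `ε [u]`, `ε' [u]`. -/
noncomputable def shiftVar (ι : Time → Time2) (ε ε' : ℂ) (v : Time) :
    MvPowerSeries (Option Time2) ℂ :=
  (MvPowerSeries.X (some (ι v)) : MvPowerSeries (Option Time2) ℂ) +
      Sum.elim
        (fun m : ℕ+ => MvPowerSeries.C (ε / ((m : ℕ) : ℂ)) * MvPowerSeries.X none ^ (m : ℕ))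
        (fun m : ℕ+ => MvPowerSeries.C (ε' / ((m : ℕ) : ℂ)) * MvPowerSeries.X none ^ (m : ℕ)) v

lemma hasSubst_shiftVar {ι : Time → Time2} (hι : Function.Injective ι) (ε ε' : ℂ) :
    MvPowerSeries.HasSubst (shiftVar ι ε ε') := by
  classical
  constructor
  · intro v
    have : MvPowerSeries.constantCoeff (shiftVar ι ε ε' v) = 0 := by
      cases v <;> simp [shiftVar]
    rw [this]
    exact IsNilpotent.zero
  · intro d
    -- The monomial `d` can come from a shift `u^m` only if `m` is at most its exponent of `u`, and
    -- from the unshifted variable for at most one `v`.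
    refine Set.Finite.subset ((Set.finite_le_nat (d none)).preimage (f := fun m : ℕ+ => (m : ℕ))
      (PNat.coe_injective.injOn) |>.image Sum.inl |>.union
      (((Set.finite_le_nat (d none)).preimage (f := fun m : ℕ+ => (m : ℕ))
      (PNat.coe_injective.injOn)).image Sum.inr) |>.union
      (Set.Subsingleton.finite (s := {v | d = Finsupp.single (some (ι v)) 1}) fun v hv u hu =>
        hι (Option.some_injective _ (Finsupp.single_left_injective one_ne_zero
          (hv.symm.trans hu))))) ?_
    intro v hv
    by_cases hd : d = Finsupp.single (some (ι v)) 1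
    · exact Or.inr hd
    · left
      have hX : MvPowerSeries.coeff d
          (MvPowerSeries.X (some (ι v)) : MvPowerSeries (Option Time2) ℂ) = 0 := by
        rw [MvPowerSeries.coeff_X, if_neg hd]
      have hv' : MvPowerSeries.coeff d (shiftVar ι ε ε' v) ≠ 0 := hv
      rw [shiftVar, map_add, hX, zero_add] at hv'
      have key : ∀ (c : ℂ) (m : ℕ), MvPowerSeries.coeff d (MvPowerSeries.C c *
          (MvPowerSeries.X none : MvPowerSeries (Option Time2) ℂ) ^ m) ≠ 0 → m ≤ d none := by
        intro c m h
        rw [MvPowerSeries.coeff_C_mul, MvPowerSeries.coeff_X_pow] at h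
        have := (ite_ne_right_iff.mp (right_ne_zero_of_mul h)).1
        rw [this, Finsupp.single_eq_same]
      cases v with
      | inl m => exact Or.inl ⟨m, key _ _ hv', rfl⟩
      | inr m => exact Or.inr ⟨m, key _ _ hv', rfl⟩

/-- The shift followed by the expansion in `u`. -/
noncomputable def shiftHom {ι : Time → Time2} (hι : Function.Injective ι) (ε ε' : ℂ) :
    MvPowerSeries Time ℂ →ₐ[ℂ] PowerSeries (MvPowerSeries Time2 ℂ) :=
  (MvPowerSeries.optionEquivLeft Time2 ℂ).toAlgHom.comp
    (MvPowerSeries.substAlgHom (hasSubst_shiftVar hι ε ε'))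

lemma shiftHom_apply {ι : Time → Time2} (hι : Function.Injective ι) (ε ε' : ℂ)
    (f : MvPowerSeries Time ℂ) :
    shiftHom hι ε ε' f = MvPowerSeries.optionEquivLeft Time2 ℂ (miwaShift ι ε ε' f) := by
  rw [shiftHom, AlgHom.comp_apply, MvPowerSeries.substAlgHom_apply]
  rfl

lemma continuous_coeff_shiftHom {ι : Time → Time2} (hι : Function.Injective ι) (ε ε' : ℂ)
    (n : ℕ) : Continuous fun f => PowerSeries.coeff n (shiftHom hι ε ε' f) := by
  simp only [shiftHom_apply]
  exact (continuous_coeff_optionEquivLeft n).comp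
    (continuous_subst_complex (hasSubst_shiftVar hι ε ε'))

lemma shiftHom_schurSeries {ι : Time → Time2} (hι : Function.Injective ι) (ε ε' : ℂ)
    (a : ℕ+ → MvPolynomial Time ℂ) (k : ℕ) :
    shiftHom hι ε ε' (schurSeries a k) =
      PowerSeries.coeff k (schurGen fun m => shiftHom hι ε ε' (a m : MvPowerSeries Time ℂ)) := by
  rw [coeff_schurGen, schurSeries]
  have h := MvPolynomial.comp_aeval a
    ((shiftHom hι ε ε').comp (MvPolynomial.coeToMvPowerSeries.algHom (σ := Time) (R := ℂ) ℂ))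
  have h2 := DFunLike.congr_fun h (elemSchurNat k)
  simpa using h2

lemma shiftHom_X {ι : Time → Time2} (hι : Function.Injective ι) (ε ε' : ℂ) (v : Time) :
    shiftHom hι ε ε' (MvPowerSeries.X v) =
      algebraMap (MvPowerSeries Time2 ℂ)
        (PowerSeries (MvPowerSeries Time2 ℂ)) (MvPowerSeries.X (ι v)) +
      algebraMap ℂ (PowerSeries (MvPowerSeries Time2 ℂ))
        (Sum.elim (fun m : ℕ+ => ε / ((m : ℕ) : ℂ)) (fun m : ℕ+ => ε' / ((m : ℕ) : ℂ)) v) *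
        PowerSeries.X ^ (Sum.elim (fun m : ℕ+ => (m : ℕ)) (fun m : ℕ+ => (m : ℕ)) v) := by
  rw [shiftHom, AlgHom.comp_apply, MvPowerSeries.substAlgHom_X]
  have hC : ∀ c : ℂ, (algebraMap ℂ (PowerSeries (MvPowerSeries Time2 ℂ))) c =
    PowerSeries.C (MvPowerSeries.C c) := fun c => by
      rw [PowerSeries.algebraMap_apply, MvPowerSeries.algebraMap_apply]; rfl
  cases v <;> simp [shiftVar, hC]

/-- `h_k(t)` or `h_k(s)`. -/
noncomputable def elemLeft₂ (ι : Time → Time2) : ℕ → MvPowerSeries Time2 ℂ :=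
  schurSeries fun m => MvPolynomial.X (ι (Sum.inl m))

/-- `h_k(t')` or `h_k(s')`. -/
noncomputable def elemRight₂ (ι : Time → Time2) : ℕ → MvPowerSeries Time2 ℂ :=
  schurSeries fun m => MvPolynomial.X (ι (Sum.inr m))

lemma coeff_schurGen_algebraMap_X (e : ℕ+ → Time2) (k : ℕ) :
    PowerSeries.coeff k (schurGen fun m => (algebraMap (MvPowerSeries Time2 ℂ)
      (PowerSeries (MvPowerSeries Time2 ℂ)) (MvPowerSeries.X (e m)))) =
      PowerSeries.C (schurSeries (fun m => MvPolynomial.X (e m)) k) := by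
  rw [coeff_schurGen, schurSeries]
  have h := MvPolynomial.comp_aeval (fun m => (MvPolynomial.X (e m) : MvPolynomial Time2 ℂ))
    ((IsScalarTower.toAlgHom ℂ (MvPowerSeries Time2 ℂ) (PowerSeries (MvPowerSeries Time2 ℂ))).comp
    (MvPolynomial.coeToMvPowerSeries.algHom (σ := Time2) (R := ℂ) ℂ))
  have h2 := DFunLike.congr_fun h (elemSchurNat k)
  simpa using h2.symm

lemma schurGen_shift_one {R : Type*} [CommRing R] [Algebra ℂ R] (u : R) :
    schurGen (fun m : ℕ+ => algebraMap ℂ R (1 / ((m : ℕ) : ℂ)) * u ^ (m : ℕ)) =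
      PowerSeries.mk fun k => algebraMap ℂ R 1 * u ^ k := by
  rw [schurGen_geom]
  simp

lemma schurGen_shift_neg_one {R : Type*} [CommRing R] [Algebra ℂ R] (u : R) :
    schurGen (fun m : ℕ+ => algebraMap ℂ R (-1 / ((m : ℕ) : ℂ)) * u ^ (m : ℕ)) =
      PowerSeries.mk fun k => algebraMap ℂ R (if k = 0 then 1 else if k = 1 then -1 else 0) *
        u ^ k := by
  rw [schurGen_geom_neg]
  ext1 k
  rw [map_sub, PowerSeries.coeff_C_mul, PowerSeries.coeff_one, PowerSeries.coeff_X,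
    PowerSeries.coeff_mk]
  rcases k with _ | _ | k <;> simp

/-- The sequence `r` treats both signs at once: it is `1, 1, 1, …` for `+[u]` and `1, -1, 0, 0, …`
for `-[u]`. -/
lemma coeff_schurGen_shift (e : ℕ+ → Time2) {ε : ℂ} {r : ℕ → ℂ}
    (hr : schurGen (fun m : ℕ+ => algebraMap ℂ (PowerSeries (MvPowerSeries Time2 ℂ))
      (ε / ((m : ℕ) : ℂ)) * PowerSeries.X ^ (m : ℕ)) =
      PowerSeries.mk fun k => algebraMap ℂ _ (r k) * PowerSeries.X ^ k) (k : ℕ) :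
    PowerSeries.coeff k (schurGen fun m => algebraMap (MvPowerSeries Time2 ℂ)
        (PowerSeries (MvPowerSeries Time2 ℂ)) (MvPowerSeries.X (e m)) +
      algebraMap ℂ (PowerSeries (MvPowerSeries Time2 ℂ)) (ε / ((m : ℕ) : ℂ)) *
        PowerSeries.X ^ (m : ℕ)) =
    PowerSeries.mk fun n => if n ≤ k then
      MvPowerSeries.C (r n) * schurSeries (fun m => MvPolynomial.X (e m)) (k - n) else 0 := by
  have h := congrArg (PowerSeries.coeff k) (schurGen_add
    (fun m => algebraMap (MvPowerSeries Time2 ℂ)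
        (PowerSeries (MvPowerSeries Time2 ℂ)) (MvPowerSeries.X (e m)))
    (fun m : ℕ+ => algebraMap ℂ (PowerSeries (MvPowerSeries Time2 ℂ)) (ε / ((m : ℕ) : ℂ)) *
      PowerSeries.X ^ (m : ℕ)))
  refine h.trans ?_
  rw [hr, PowerSeries.coeff_mul]
  ext1 n
  rw [map_sum, PowerSeries.coeff_mk]
  have hC : ∀ c : ℂ, (algebraMap ℂ (PowerSeries (MvPowerSeries Time2 ℂ))) c =
    PowerSeries.C (MvPowerSeries.C c) := fun c => by
      rw [PowerSeries.algebraMap_apply, MvPowerSeries.algebraMap_apply]; rfl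
  simp only [coeff_schurGen_algebraMap_X, PowerSeries.coeff_mk, PowerSeries.coeff_C_mul, hC,
    PowerSeries.coeff_X_pow]
  split_ifs with hn
  · rw [Finset.sum_eq_single (k - n, n)]
    · simp [mul_comm]
    · rintro ⟨i, j⟩ hij hne
      rw [if_neg, mul_zero, mul_zero]
      rintro rfl
      have := Finset.HasAntidiagonal.mem_antidiagonal.mp hij
      exact hne (Prod.ext (by simp only at this ⊢; omega) rfl)
    · intro hne
      exact absurd (Finset.HasAntidiagonal.mem_antidiagonal.mpr (Nat.sub_add_cancel hn)) hne
  · refine Finset.sum_eq_zero fun p hp => ?_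
    have := Finset.HasAntidiagonal.mem_antidiagonal.mp hp
    rw [if_neg (by omega), mul_zero, mul_zero]

/-! ### Miwa shifts of `h_k` and of the entries of `U(t) G U(t')ᵀ` -/

variable {ι : Time → Time2} (hι : Function.Injective ι)

lemma shiftHom_elemLeft {ε : ℂ} (ε' : ℂ) {r : ℕ → ℂ}
    (hr : schurGen (fun m : ℕ+ => algebraMap ℂ (PowerSeries (MvPowerSeries Time2 ℂ))
      (ε / ((m : ℕ) : ℂ)) * PowerSeries.X ^ (m : ℕ)) =
      PowerSeries.mk fun k => algebraMap ℂ _ (r k) * PowerSeries.X ^ k) (k : ℕ) :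
    shiftHom hι ε ε' (elemLeft k) = PowerSeries.mk fun n =>
      if n ≤ k then MvPowerSeries.C (r n) * elemLeft₂ ι (k - n) else 0 := by
  rw [elemLeft, shiftHom_schurSeries]
  simp only [MvPolynomial.coe_X, shiftHom_X, Sum.elim_inl]
  exact coeff_schurGen_shift _ hr k

lemma shiftHom_elemRight (ε : ℂ) {ε' : ℂ} {r : ℕ → ℂ}
    (hr : schurGen (fun m : ℕ+ => algebraMap ℂ (PowerSeries (MvPowerSeries Time2 ℂ))
      (ε' / ((m : ℕ) : ℂ)) * PowerSeries.X ^ (m : ℕ)) =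
      PowerSeries.mk fun k => algebraMap ℂ _ (r k) * PowerSeries.X ^ k) (k : ℕ) :
    shiftHom hι ε ε' (elemRight k) = PowerSeries.mk fun n =>
      if n ≤ k then MvPowerSeries.C (r n) * elemRight₂ ι (k - n) else 0 := by
  rw [elemRight, shiftHom_schurSeries]
  simp only [MvPolynomial.coe_X, shiftHom_X, Sum.elim_inr]
  exact coeff_schurGen_shift _ hr k

lemma shiftHom_elemLeft_zero (ε' : ℂ) (k : ℕ) :
    shiftHom hι 0 ε' (elemLeft k) = PowerSeries.C (elemLeft₂ ι k) := by
  rw [elemLeft, shiftHom_schurSeries]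
  simp only [MvPolynomial.coe_X, shiftHom_X, Sum.elim_inl, zero_div, map_zero, zero_mul, add_zero]
  exact coeff_schurGen_algebraMap_X _ k

lemma shiftHom_elemRight_zero (ε : ℂ) (k : ℕ) :
    shiftHom hι ε 0 (elemRight k) = PowerSeries.C (elemRight₂ ι k) := by
  rw [elemRight, shiftHom_schurSeries]
  simp only [MvPolynomial.coe_X, shiftHom_X, Sum.elim_inr, zero_div, map_zero, zero_mul, add_zero]
  exact coeff_schurGen_algebraMap_X _ k

lemma locFinite_elemLeft : LocFinite elemLeft :=
  locFinite_schurSeries (Sum.elim (fun m : ℕ+ => (m : ℕ)) fun m : ℕ+ => (m : ℕ)) _ fun _ =>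
    MvPolynomial.isWeightedHomogeneous_X ℂ _ _

lemma locFinite_elemRight : LocFinite elemRight :=
  locFinite_schurSeries (Sum.elim (fun m : ℕ+ => (m : ℕ)) fun m : ℕ+ => (m : ℕ)) _ fun _ =>
    MvPolynomial.isWeightedHomogeneous_X ℂ _ _

lemma locFinite_elemLeft₂ {ι : Time → Time2} (hι : Function.Injective ι) :
    LocFinite (elemLeft₂ ι) := by
  refine locFinite_schurSeries (Function.extend (fun m : ℕ+ => ι (Sum.inl m)) (fun m => (m : ℕ)) 0)
    _ fun m => ?_
  have h := MvPolynomial.isWeightedHomogeneous_X ℂ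
    (Function.extend (fun m : ℕ+ => ι (Sum.inl m)) (fun m => (m : ℕ)) 0) (ι (Sum.inl m))
  have e : Function.extend (fun m : ℕ+ => ι (Sum.inl m)) (fun m => (m : ℕ)) 0 (ι (Sum.inl m)) = m :=
    (hι.comp Sum.inl_injective).extend_apply _ _ m
  rwa [e] at h

lemma locFinite_elemRight₂ {ι : Time → Time2} (hι : Function.Injective ι) :
    LocFinite (elemRight₂ ι) := by
  refine locFinite_schurSeries (Function.extend (fun m : ℕ+ => ι (Sum.inr m)) (fun m => (m : ℕ)) 0)
    _ fun m => ?_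
  have h := MvPolynomial.isWeightedHomogeneous_X ℂ
    (Function.extend (fun m : ℕ+ => ι (Sum.inr m)) (fun m => (m : ℕ)) 0) (ι (Sum.inr m))
  have e : Function.extend (fun m : ℕ+ => ι (Sum.inr m)) (fun m => (m : ℕ)) 0 (ι (Sum.inr m)) = m :=
    (hι.comp Sum.inr_injective).extend_apply _ _ m
  rwa [e] at h

/-- A shift of the first sequence of times moves the rows of `U(f) G U(g)ᵀ`. -/
lemma coeff_map_momentSum_of_shift {σ τ : Type*} (G : ℕ → ℕ → ℂ)
    {f g : ℕ → MvPowerSeries σ ℂ} (hf : LocFinite f) (hg : LocFinite g)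
    {f' g' : ℕ → MvPowerSeries τ ℂ} (hf' : LocFinite f') (hg' : LocFinite g')
    (φ : MvPowerSeries σ ℂ →ₗ[ℂ] MvPowerSeries τ ℂ) (hφ : Continuous φ) (n : ℕ) (r : ℂ)
    (h : ∀ a b, φ (f a * g b) =
      if n ≤ a then MvPowerSeries.C r * (f' (a - n) * g' b) else 0) (i j : ℕ) :
    φ (momentSum G f g i j) = MvPowerSeries.C r * momentSum G f' g' (i + n) j := by
  have h1 := map_momentSum G hf hg φ hφ i j
  have h2 := (hasSum_momentSum G hf' hg' (i + n) j).mul_left (MvPowerSeries.C r)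
  have hinj : Function.Injective fun p : ℕ × ℕ => (p.1 + n, p.2) := fun p q hpq => by
    simp only [Prod.mk.injEq, add_left_inj] at hpq
    exact Prod.ext hpq.1 hpq.2
  refine h1.unique ((hinj.hasSum_iff ?_).mp (h2.congr_fun fun p => ?_))
  · rintro ⟨a, b⟩ hab
    rw [h, if_neg, mul_zero]
    intro hna
    exact hab ⟨(a - n, b), by simp [Nat.sub_add_cancel hna]⟩
  · simp only [Function.comp_apply]
    rw [h, if_pos (Nat.le_add_left _ _), Nat.add_sub_cancel, add_assoc, add_comm p.1 n]
    ring

/-- The coefficient of `u ^ n` after the shift by `ε [u]`, `ε' [u]`. -/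
noncomputable def shiftCoeff (ε ε' : ℂ) (n : ℕ) :
    MvPowerSeries Time ℂ →ₗ[ℂ] MvPowerSeries Time2 ℂ where
  toFun f := PowerSeries.coeff n (shiftHom hι ε ε' f)
  map_add' f g := by rw [map_add, map_add]
  map_smul' c f := by rw [map_smul]; rfl

lemma shiftHom_left_momentSum (G : ℕ → ℕ → ℂ) {ε : ℂ} {r : ℕ → ℂ}
    (hr : schurGen (fun m : ℕ+ => algebraMap ℂ (PowerSeries (MvPowerSeries Time2 ℂ))
      (ε / ((m : ℕ) : ℂ)) * PowerSeries.X ^ (m : ℕ)) =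
      PowerSeries.mk fun k => algebraMap ℂ _ (r k) * PowerSeries.X ^ k) (i j : ℕ) :
    shiftHom hι ε 0 (momentSum G elemLeft elemRight i j) = PowerSeries.mk fun n =>
      MvPowerSeries.C (r n) * momentSum G (elemLeft₂ ι) (elemRight₂ ι) (i + n) j := by
  ext1 n
  rw [PowerSeries.coeff_mk]
  refine coeff_map_momentSum_of_shift G locFinite_elemLeft locFinite_elemRight
    (locFinite_elemLeft₂ hι) (locFinite_elemRight₂ hι) (shiftCoeff hι ε 0 n)
    (continuous_coeff_shiftHom hι ε 0 n) n (r n) (fun a b => ?_) i j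
  change PowerSeries.coeff n (shiftHom hι ε 0 _) = _
  rw [map_mul, shiftHom_elemLeft hι 0 hr, shiftHom_elemRight_zero, PowerSeries.coeff_mul_C,
    PowerSeries.coeff_mk]
  split_ifs <;> ring

lemma shiftHom_right_momentSum (G : ℕ → ℕ → ℂ) {ε' : ℂ} {r : ℕ → ℂ}
    (hr : schurGen (fun m : ℕ+ => algebraMap ℂ (PowerSeries (MvPowerSeries Time2 ℂ))
      (ε' / ((m : ℕ) : ℂ)) * PowerSeries.X ^ (m : ℕ)) =
      PowerSeries.mk fun k => algebraMap ℂ _ (r k) * PowerSeries.X ^ k) (i j : ℕ) :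
    shiftHom hι 0 ε' (momentSum G elemLeft elemRight i j) = PowerSeries.mk fun n =>
      MvPowerSeries.C (r n) * momentSum G (elemLeft₂ ι) (elemRight₂ ι) i (j + n) := by
  ext1 n
  rw [PowerSeries.coeff_mk, momentSum_swap, momentSum_swap G (elemLeft₂ ι)]
  refine coeff_map_momentSum_of_shift _ locFinite_elemRight locFinite_elemLeft
    (locFinite_elemRight₂ hι) (locFinite_elemLeft₂ hι) (shiftCoeff hι 0 ε' n)
    (continuous_coeff_shiftHom hι 0 ε' n) n (r n) (fun a b => ?_) j i
  change PowerSeries.coeff n (shiftHom hι 0 ε' _) = _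
  rw [map_mul, shiftHom_elemRight hι 0 hr, shiftHom_elemLeft_zero, PowerSeries.coeff_mul_C,
    PowerSeries.coeff_mk]
  split_ifs <;> ring

end Subst

/-! ## Determinants of shifted matrices -/

section Determinants

variable {R : Type*} [CommRing R]

/-- Reversing the order of the rows turns this into the row operation with the preceding row. -/
lemma det_eq_of_row_eq_smul_add_next {n : ℕ} {A B : Matrix (Fin (n + 1)) (Fin (n + 1)) R} (c : R)
    (hlast : ∀ j, A (Fin.last n) j = B (Fin.last n) j)
    (hcast : ∀ (i : Fin n) (j), A i.castSucc j = B i.castSucc j + c * A i.succ j) :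
    A.det = B.det := by
  rw [← Matrix.det_submatrix_equiv_self Fin.revPerm A,
    ← Matrix.det_submatrix_equiv_self Fin.revPerm B]
  refine Matrix.det_eq_of_forall_row_eq_smul_add_pred (fun _ => c) (fun j => ?_) fun i j => ?_
  · simp [hlast]
  · simp [Fin.rev_succ, Fin.rev_castSucc, hcast]

/-- The minor of the rows `≤ n` except `κ` and the columns `< n`. -/
def minorRow (A : ℕ → ℕ → R) (n : ℕ) (κ : Fin (n + 1)) : R :=
  Matrix.det (Matrix.of fun i j : Fin n => A (κ.succAbove i) j)

/-- The expansion along the last row of the determinant with rows `0, …, m - 1, p`. -/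
def bordered (A : ℕ → ℕ → R) (m p : ℕ) : R :=
  ∑ l : Fin (m + 1), (-1) ^ (m + (l : ℕ)) * A p l * minorRow (fun i j => A j i) m l

lemma bordered_eq_det (A : ℕ → ℕ → R) (m p : ℕ) :
    bordered A m p = Matrix.det (Matrix.of fun i j : Fin (m + 1) =>
      A (if (i : ℕ) < m then i else p) j) := by
  rw [Matrix.det_succ_row _ (Fin.last m), bordered]
  refine Finset.sum_congr rfl fun l _ => ?_
  congr 1
  · simp
  · rw [minorRow, ← Matrix.det_transpose]
    congr 1
    ext i j
    simp [Matrix.transpose_apply]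

lemma bordered_of_lt (A : ℕ → ℕ → R) {m p : ℕ} (hp : p < m) : bordered A m p = 0 := by
  rw [bordered_eq_det]
  refine Matrix.det_zero_of_row_eq (i := ⟨p, by omega⟩) (j := Fin.last m) ?_ ?_
  · exact Fin.ne_of_val_ne (by simp; omega)
  · ext j
    simp [hp]

/-- Row `n` and a last column `X^{n-i}` are adjoined. Subtracting `X` times the next row clears that
column except for the final `1` and leaves the given matrix; expanding the bordered matrix along the
column gives the sum. -/
lemma det_sub_X_mul (A : ℕ → ℕ → R) (n : ℕ) :
    Matrix.det (Matrix.of fun i j : Fin n =>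
      (PowerSeries.C (A i j) - PowerSeries.X * PowerSeries.C (A (i + 1) j) : PowerSeries R)) =
      ∑ κ : Fin (n + 1), PowerSeries.X ^ (n - (κ : ℕ)) *
        PowerSeries.C ((-1) ^ (n + (κ : ℕ)) * minorRow A n κ) := by
  set M : Matrix (Fin (n + 1)) (Fin (n + 1)) (PowerSeries R) := Matrix.of fun i j =>
    if (j : ℕ) < n then PowerSeries.C (A i j) else PowerSeries.X ^ (n - (i : ℕ)) with hM
  set N : Matrix (Fin (n + 1)) (Fin (n + 1)) (PowerSeries R) := Matrix.of fun i j =>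
    if (i : ℕ) < n then (if (j : ℕ) < n then
      PowerSeries.C (A i j) - PowerSeries.X * PowerSeries.C (A (i + 1) j) else 0)
    else M i j with hN
  have h1 : M.det = N.det := by
    refine det_eq_of_row_eq_smul_add_next PowerSeries.X (fun j => by simp [hN]) fun i j => ?_
    simp only [hM, hN, Matrix.of_apply, Fin.val_castSucc, i.2, if_true, Fin.val_succ]
    split_ifs with hj
    · ring
    · rw [← pow_succ', zero_add]
      congr 1
      omega
  have h2 : N.det = Matrix.det (Matrix.of fun i j : Fin n =>
      (PowerSeries.C (A i j) - PowerSeries.X * PowerSeries.C (A (i + 1) j) : PowerSeries R)) := by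
    rw [Matrix.det_succ_column _ (Fin.last n), Fin.sum_univ_castSucc,
      Finset.sum_eq_zero (fun i _ => by simp [hN]), zero_add]
    simp only [hN, hM, Fin.val_last, lt_irrefl, if_false, Matrix.of_apply, ← two_mul, pow_mul,
      neg_one_sq, one_pow, tsub_self, pow_zero, one_mul]
    congr 1
    ext1 i j
    simp
  rw [← h2, ← h1, Matrix.det_succ_column _ (Fin.last n)]
  refine Finset.sum_congr rfl fun κ _ => ?_
  have h3 : Matrix.det (M.submatrix κ.succAbove (Fin.last n).succAbove) =
      PowerSeries.C (minorRow A n κ) := by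
    rw [minorRow, RingHom.map_det]
    congr 1
    ext1 i j
    simp [hM]
  rw [h3]
  simp only [hM, Matrix.of_apply, Fin.val_last, lt_irrefl, if_false, map_mul, map_pow, map_neg,
    map_one, add_comm n]
  ring

/-- Row `i` equals `A_i` plus `X` times row `i + 1`, so row operations make all rows but the last
constant. -/
lemma coeff_det_mk (A : ℕ → ℕ → R) (m d : ℕ) :
    PowerSeries.coeff d (Matrix.det (Matrix.of fun i j : Fin (m + 1) =>
      (PowerSeries.mk fun c => A (i + c) j : PowerSeries R))) = bordered A m (m + d) := by
  set N : Matrix (Fin (m + 1)) (Fin (m + 1)) (PowerSeries R) := Matrix.of fun i j =>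
    if (i : ℕ) < m then PowerSeries.C (A i j) else PowerSeries.mk fun c => A (i + c) j with hN
  have h1 : Matrix.det (Matrix.of fun i j : Fin (m + 1) =>
      (PowerSeries.mk fun c => A (i + c) j : PowerSeries R)) = N.det := by
    refine det_eq_of_row_eq_smul_add_next PowerSeries.X (fun j => by simp [hN]) fun i j => ?_
    simp only [hN, Matrix.of_apply, Fin.val_castSucc, i.2, if_true, Fin.val_succ]
    ext1 k
    cases k with
    | zero => simp
    | succ k =>
      rw [map_add, PowerSeries.coeff_succ_X_mul, PowerSeries.coeff_mk, PowerSeries.coeff_mk,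
        PowerSeries.coeff_C, if_neg k.succ_ne_zero, zero_add, add_assoc, add_comm 1]
  rw [h1, Matrix.det_succ_row _ (Fin.last m), map_sum, bordered]
  refine Finset.sum_congr rfl fun l _ => ?_
  have h3 : Matrix.det (N.submatrix (Fin.last m).succAbove l.succAbove) =
      PowerSeries.C (minorRow (fun i j => A j i) m l) := by
    rw [minorRow, ← Matrix.det_transpose, RingHom.map_det]
    congr 1
    ext1 i j
    simp [hN]
  have h4 : (-1 : PowerSeries R) ^ ((Fin.last m : ℕ) + (l : ℕ)) =
      PowerSeries.C ((-1) ^ (m + (l : ℕ))) := by simp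
  rw [h3, h4, PowerSeries.coeff_mul_C, PowerSeries.coeff_C_mul]
  simp [hN]

/-- The common value of both sides of the bilinear identities. -/
def bilinearSum (A B A' : ℕ → ℕ → R) (n m : ℕ) : R :=
  ∑ κ : Fin (n + 1), ∑ l : Fin (m + 1), (-1) ^ (n + (κ : ℕ)) * (-1) ^ (m + (l : ℕ)) *
    (minorRow A n κ * B κ l * minorRow (fun i j => A' j i) m l)

lemma bilinearSum_swap (A B A' : ℕ → ℕ → R) (n m : ℕ) :
    bilinearSum A B A' n m =
      bilinearSum (fun i j => A' j i) (fun i j => B j i) (fun i j => A j i) m n := by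
  rw [bilinearSum, Finset.sum_comm]
  refine Finset.sum_congr rfl fun l _ => Finset.sum_congr rfl fun κ _ => ?_
  ring

/-- The coefficient of `u ^ {c + n - m}` in the product of the two shifted determinants. -/
lemma coeff_det_mul_det (A A' : ℕ → ℕ → R) (n m c : ℕ) :
    (if n + c < m then 0 else PowerSeries.coeff (n + c - m)
      (Matrix.det (Matrix.of fun i j : Fin n =>
        (PowerSeries.C (A i j) - PowerSeries.X * PowerSeries.C (A (i + 1) j) : PowerSeries R)) *
      Matrix.det (Matrix.of fun i j : Fin (m + 1) =>
        (PowerSeries.mk fun c => A' (i + c) j : PowerSeries R)))) =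
      ∑ κ : Fin (n + 1), (-1) ^ (n + (κ : ℕ)) * minorRow A n κ * bordered A' m (c + κ) := by
  split_ifs with h
  · refine (Finset.sum_eq_zero fun κ _ => ?_).symm
    -- Here `c + κ ≤ c + n < m`, so the last row repeats an earlier one: negative powers of `u`
    -- match vanishing determinants.
    rw [bordered_of_lt A' (by omega), mul_zero]
  · rw [det_sub_X_mul, Finset.sum_mul, map_sum]
    refine Finset.sum_congr rfl fun κ _ => ?_
    rw [mul_assoc, PowerSeries.coeff_X_pow_mul']
    split_ifs with h2
    · rw [PowerSeries.coeff_C_mul, coeff_det_mk]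
      congr 2
      omega
    · rw [bordered_of_lt A' (by omega), mul_zero]

/-- The bordered determinant is linear in its last row, so summation over `c` replaces row `c + κ`
of `A'` by row `κ` of `B`. -/
lemma hasSum_coeff_det_mul_det [TopologicalSpace R] [IsTopologicalRing R]
    (A B A' : ℕ → ℕ → R) (h : ℕ → R)
    (hB : ∀ i j, HasSum (fun c => h c * A' (c + i) j) (B i j)) (n m : ℕ) :
    HasSum (fun c => (∑ κ : Fin (n + 1), (-1) ^ (n + (κ : ℕ)) * minorRow A n κ *
        bordered A' m (c + κ)) * h c) (bilinearSum A B A' n m) := by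
  refine (hasSum_sum fun (κ : Fin (n + 1)) _ => hasSum_sum fun (l : Fin (m + 1)) _ =>
    (((hB κ l).mul_left (minorRow A n κ)).mul_right
      (minorRow (fun i j => A' j i) m l)).mul_left
        ((-1) ^ (n + (κ : ℕ)) * (-1) ^ (m + (l : ℕ)))).congr_fun fun c => ?_
  simp only [bordered, Finset.sum_mul, Finset.mul_sum]
  refine Finset.sum_congr rfl fun κ _ => Finset.sum_congr rfl fun l _ => ?_
  ring

end Determinants

/-! ## The bilinear identities for the principal minors of `U(t) G U(t')ᵀ` -/

/-- The principal minors of `U(t) G U(t')ᵀ`. -/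
noncomputable def momentDet (G : ℕ → ℕ → ℂ) (n : ℕ) : MvPowerSeries Time ℂ :=
  Matrix.det (Matrix.of fun i j : Fin n => momentSum G elemLeft elemRight i j)

lemma coe_aeval_elemSchur (a : ℕ+ → MvPolynomial Time2 ℂ) (c : ℕ) :
    ((MvPolynomial.aeval a (elemSchur (c : ℤ)) : MvPolynomial Time2 ℂ) : MvPowerSeries Time2 ℂ) =
      schurSeries a c := by
  simp [elemSchur, schurSeries]

lemma residue_eq_bilinearSum (A B A' : ℕ → ℕ → MvPowerSeries Time2 ℂ)
    (a : ℕ+ → MvPolynomial Time2 ℂ) (P : MvPowerSeries (Option Time2) ℂ) (n m : ℕ)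
    (hB : ∀ i j, HasSum (fun c => schurSeries a c * A' (c + i) j) (B i j))
    (hP : MvPowerSeries.optionEquivLeft Time2 ℂ P =
      Matrix.det (Matrix.of fun i j : Fin n => (PowerSeries.C (A i j) - PowerSeries.X *
        PowerSeries.C (A (i + 1) j) : PowerSeries (MvPowerSeries Time2 ℂ))) *
      Matrix.det (Matrix.of fun i j : Fin (m + 1) =>
        (PowerSeries.mk fun c => A' (i + c) j : PowerSeries (MvPowerSeries Time2 ℂ)))) :
    residue ((n : ℤ) - m - 1) P a = bilinearSum A B A' n m := by
  rw [residue, ← (hasSum_coeff_det_mul_det A B A' (schurSeries a) hB n m).tsum_eq]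
  refine tsum_congr fun c => ?_
  rw [coe_aeval_elemSchur, ← coeff_det_mul_det, ← hP]
  congr 1
  split_ifs with h
  · exact uCoeff_of_neg (by omega) P
  · rw [← uCoeff_eq]
    congr 1
    omega

lemma coeff_det_sub_X_mul_of_lt {R : Type*} [CommRing R] (A : ℕ → ℕ → R) {n k : ℕ} (hk : n < k) :
    PowerSeries.coeff k (Matrix.det (Matrix.of fun i j : Fin n =>
      (PowerSeries.C (A i j) - PowerSeries.X * PowerSeries.C (A (i + 1) j) : PowerSeries R))) =
      0 := by
  rw [det_sub_X_mul, map_sum]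
  refine Finset.sum_eq_zero fun κ _ => ?_
  rw [PowerSeries.coeff_X_pow_mul', if_pos (by omega), PowerSeries.coeff_C, if_neg (by omega)]

/-- The boundary case where the other tau factor is `τ(0) = 1`: the determinant has degree at most
`n` in `u`, while the residue uses only coefficients of index at least `n + 1`. -/
lemma residue_eq_zero (A : ℕ → ℕ → MvPowerSeries Time2 ℂ)
    (a : ℕ+ → MvPolynomial Time2 ℂ) (P : MvPowerSeries (Option Time2) ℂ) (n : ℕ)
    (hP : MvPowerSeries.optionEquivLeft Time2 ℂ P =
      Matrix.det (Matrix.of fun i j : Fin n => (PowerSeries.C (A i j) - PowerSeries.X *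
        PowerSeries.C (A (i + 1) j) : PowerSeries (MvPowerSeries Time2 ℂ)))) :
    residue n P a = 0 := by
  rw [residue]
  refine (tsum_congr fun c => ?_).trans tsum_zero
  have h : ((c : ℤ) + n + 1) = ((c + n + 1 : ℕ) : ℤ) := by push_cast; rfl
  rw [h, uCoeff_eq, hP, coeff_det_sub_X_mul_of_lt A (by omega), zero_mul]

lemma residue_zero (r : ℤ) (a : ℕ+ → MvPolynomial Time2 ℂ) : residue r 0 a = 0 := by
  rw [residue]
  refine (tsum_congr fun c => ?_).trans tsum_zero
  have h : uCoeff ((c : ℤ) + r + 1) 0 = 0 := by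
    funext d
    simp only [uCoeff, map_zero, ite_self]
    rfl
  rw [h, zero_mul]

lemma miwaShift_zero {ι : Time → Time2} (hι : Function.Injective ι) (ε ε' : ℂ) :
    miwaShift ι ε ε' 0 = 0 := by
  refine (MvPowerSeries.optionEquivLeft Time2 ℂ).injective ?_
  rw [← shiftHom_apply hι, map_zero, map_zero]

lemma miwaShift_one {ι : Time → Time2} (hι : Function.Injective ι) (ε ε' : ℂ) :
    miwaShift ι ε ε' 1 = 1 := by
  refine (MvPowerSeries.optionEquivLeft Time2 ℂ).injective ?_
  rw [← shiftHom_apply hι, map_one, map_one]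

/-! ### Miwa shifts of the principal minors -/

section Shift

variable {ι : Time → Time2} (G : ℕ → ℕ → ℂ)

lemma shiftHom_momentDet (hι : Function.Injective ι) (ε ε' : ℂ) (n : ℕ) : shiftHom hι ε ε' (momentDet G n) =
    Matrix.det (Matrix.of fun i j : Fin n =>
      shiftHom hι ε ε' (momentSum G elemLeft elemRight i j)) := by
  rw [momentDet, AlgHom.map_det]
  rfl

lemma mk_shift_neg_one {R : Type*} [CommRing R] [Algebra ℂ R] (f : ℕ → R) :
    (PowerSeries.mk fun n => algebraMap ℂ R (if n = 0 then 1 else if n = 1 then -1 else 0) * f n :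
      PowerSeries R) = PowerSeries.C (f 0) - PowerSeries.X * PowerSeries.C (f 1) := by
  ext1 n
  rw [PowerSeries.coeff_mk, map_sub, PowerSeries.coeff_C, PowerSeries.coeff_mul_C,
    PowerSeries.coeff_X]
  rcases n with _ | _ | n <;> simp

lemma optionEquivLeft_shift_left_neg_one (hι : Function.Injective ι) (n : ℕ) :
    MvPowerSeries.optionEquivLeft Time2 ℂ (miwaShift ι (-1) 0 (momentDet G n)) =
      Matrix.det (Matrix.of fun i j : Fin n =>
        (PowerSeries.C (momentSum G (elemLeft₂ ι) (elemRight₂ ι) i j) - PowerSeries.X *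
          PowerSeries.C (momentSum G (elemLeft₂ ι) (elemRight₂ ι) (i + 1) j) :
            PowerSeries (MvPowerSeries Time2 ℂ))) := by
  rw [← shiftHom_apply hι, shiftHom_momentDet G hι]
  congr 1
  ext1 i j
  rw [Matrix.of_apply, Matrix.of_apply,
    shiftHom_left_momentSum hι G (schurGen_shift_neg_one _)]
  exact mk_shift_neg_one fun n => momentSum G (elemLeft₂ ι) (elemRight₂ ι) (i + n) j

lemma optionEquivLeft_shift_right_neg_one (hι : Function.Injective ι) (n : ℕ) :
    MvPowerSeries.optionEquivLeft Time2 ℂ (miwaShift ι 0 (-1) (momentDet G n)) =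
      Matrix.det (Matrix.of fun i j : Fin n =>
        (PowerSeries.C (momentSum G (elemLeft₂ ι) (elemRight₂ ι) j i) - PowerSeries.X *
          PowerSeries.C (momentSum G (elemLeft₂ ι) (elemRight₂ ι) j (i + 1)) :
            PowerSeries (MvPowerSeries Time2 ℂ))) := by
  rw [← shiftHom_apply hι, shiftHom_momentDet G hι, ← Matrix.det_transpose]
  congr 1
  ext1 i j
  rw [Matrix.transpose_apply, Matrix.of_apply, Matrix.of_apply,
    shiftHom_right_momentSum hι G (schurGen_shift_neg_one _)]
  exact mk_shift_neg_one fun n => momentSum G (elemLeft₂ ι) (elemRight₂ ι) j (i + n)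

lemma optionEquivLeft_shift_left_one (hι : Function.Injective ι) (n : ℕ) :
    MvPowerSeries.optionEquivLeft Time2 ℂ (miwaShift ι 1 0 (momentDet G n)) =
      Matrix.det (Matrix.of fun i j : Fin n =>
        (PowerSeries.mk fun c => momentSum G (elemLeft₂ ι) (elemRight₂ ι) (i + c) j :
            PowerSeries (MvPowerSeries Time2 ℂ))) := by
  rw [← shiftHom_apply hι, shiftHom_momentDet G hι]
  congr 1
  ext1 i j
  rw [Matrix.of_apply, Matrix.of_apply, shiftHom_left_momentSum hι G (schurGen_shift_one _)]
  simp

lemma optionEquivLeft_shift_right_one (hι : Function.Injective ι) (n : ℕ) :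
    MvPowerSeries.optionEquivLeft Time2 ℂ (miwaShift ι 0 1 (momentDet G n)) =
      Matrix.det (Matrix.of fun i j : Fin n =>
        (PowerSeries.mk fun c => momentSum G (elemLeft₂ ι) (elemRight₂ ι) j (i + c) :
            PowerSeries (MvPowerSeries Time2 ℂ))) := by
  rw [← shiftHom_apply hι, shiftHom_momentDet G hι, ← Matrix.det_transpose]
  congr 1
  ext1 i j
  rw [Matrix.transpose_apply, Matrix.of_apply, Matrix.of_apply,
    shiftHom_right_momentSum hι G (schurGen_shift_one _)]
  simp

end Shift

lemma locFinite_schurSeries_sub {e e' : ℕ+ → Time2} (he : Function.Injective e)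
    (he' : Function.Injective e') (hee' : ∀ m n, e m ≠ e' n) :
    LocFinite (schurSeries fun m => MvPolynomial.X (e m) - MvPolynomial.X (e' m)) := by
  set w : Time2 → ℕ := Function.extend (Sum.elim e e') (Sum.elim (fun m => (m : ℕ)) fun m => m) 0
  have hinj : Function.Injective (Sum.elim e e') := he.sumElim he' hee'
  refine locFinite_schurSeries w _ fun m => ?_
  have h1 := MvPolynomial.isWeightedHomogeneous_X ℂ w (e m)
  have h2 := MvPolynomial.isWeightedHomogeneous_X ℂ w (e' m)
  have e1 : w (e m) = m := hinj.extend_apply _ _ (Sum.inl m)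
  have e2 : w (e' m) = m := hinj.extend_apply _ _ (Sum.inr m)
  rw [e1] at h1
  rw [e2] at h2
  exact h1.sub h2

/-- This is `U(t - s) U(s) = U(t)`, applied to the rows. -/
lemma hasSum_schurSeries_sub_mul_momentSum (G : ℕ → ℕ → ℂ) {e e' : ℕ+ → Time2}
    (he : Function.Injective e) (he' : Function.Injective e') (hee' : ∀ m n, e m ≠ e' n)
    {g : ℕ → MvPowerSeries Time2 ℂ} (hf : LocFinite (schurSeries fun m => MvPolynomial.X (e' m)))
    (hg : LocFinite g) (i j : ℕ) :
    HasSum (fun c => schurSeries (fun m => MvPolynomial.X (e m) - MvPolynomial.X (e' m)) c *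
        momentSum G (schurSeries fun m => MvPolynomial.X (e' m)) g (c + i) j)
      (momentSum G (schurSeries fun m => MvPolynomial.X (e m)) g i j) := by
  have h := hasSum_mul_momentSum G (locFinite_schurSeries_sub he he' hee') hf hg i j
  simp only [← schurSeries_add, sub_add_cancel] at h
  exact h

theorem isSemiInfiniteTodaTau_momentDet (G : ℕ → ℕ → ℂ) :
    IsSemiInfiniteTodaTau (momentDet G) := by
  have hl : Function.Injective (Sum.inl : Time → Time2) := Sum.inl_injective
  have hr : Function.Injective (Sum.inr : Time → Time2) := Sum.inr_injective
  have hneg : ∀ {k : ℤ}, k < 0 → extendByZero (momentDet G) k = 0 := fun hk => if_neg hk.not_ge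
  have hnat : ∀ k : ℕ, extendByZero (momentDet G) (k : ℤ) = momentDet G k := fun k => by
    simp [extendByZero]
  have hzero : extendByZero (momentDet G) 0 = 1 := by
    have := hnat 0
    rw [Nat.cast_zero] at this
    rw [this, momentDet, Matrix.det_fin_zero]
  intro n m
  rcases lt_or_ge n 0 with hn | hn
  · rw [hneg hn, miwaShift_zero hl, zero_mul, residue_zero]
    rcases lt_or_ge m 0 with hm | hm
    · rw [hneg hm, miwaShift_zero hr, mul_zero, residue_zero]
    · lift m to ℕ using hm
      -- The left side vanishes; on the right `τ(n + 1)` survives only for `n = -1`, and a degree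
      -- count then makes the residue zero.
      rcases eq_or_lt_of_le (Int.add_one_le_iff.mpr hn) with hn1 | hn1
      · obtain rfl : n = -1 := by omega
        have e : (m : ℤ) - (-1) - 1 = m := by ring
        rw [hn1, hzero, miwaShift_one hl, one_mul, hnat, e]
        exact (residue_eq_zero (fun i j => momentSum G (elemLeft₂ Sum.inr) (elemRight₂ Sum.inr) j i)
          _ _ m (optionEquivLeft_shift_right_neg_one G hr m)).symm
      · rw [hneg hn1, miwaShift_zero hl, zero_mul, residue_zero]
  lift n to ℕ using hn
  rcases lt_or_ge m 0 with hm | hm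
  · rw [hneg hm, miwaShift_zero hr, mul_zero, residue_zero]
    rcases eq_or_lt_of_le (Int.add_one_le_iff.mpr hm) with hm1 | hm1
    · obtain rfl : m = -1 := by omega
      have e : (n : ℤ) - (-1) - 1 = n := by ring
      rw [hm1, hzero, miwaShift_one hr, mul_one, hnat, e]
      exact residue_eq_zero (momentSum G (elemLeft₂ Sum.inl) (elemRight₂ Sum.inl)) _ _ n
        (optionEquivLeft_shift_left_neg_one G hl n)
    · rw [hneg hm1, miwaShift_zero hr, mul_zero, residue_zero]
  lift m to ℕ using hm
  have hn1 : (n : ℤ) + 1 = ((n + 1 : ℕ) : ℤ) := by push_cast; rfl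
  have hm1 : (m : ℤ) + 1 = ((m + 1 : ℕ) : ℤ) := by push_cast; rfl
  rw [hn1, hm1, hnat, hnat, hnat, hnat]
  have h1 := residue_eq_bilinearSum (momentSum G (elemLeft₂ Sum.inl) (elemRight₂ Sum.inl))
    (momentSum G (elemLeft₂ Sum.inl) (elemRight₂ Sum.inr))
    (momentSum G (elemLeft₂ Sum.inr) (elemRight₂ Sum.inr)) _
    (miwaShift Sum.inl (-1) 0 (momentDet G n) * miwaShift Sum.inr 1 0 (momentDet G (m + 1))) n m
    (hasSum_schurSeries_sub_mul_momentSum G (hl.comp Sum.inl_injective) (hr.comp Sum.inl_injective)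
      (fun _ _ => Sum.inl_ne_inr) (locFinite_elemLeft₂ hr) (locFinite_elemRight₂ hr))
    (by rw [map_mul, optionEquivLeft_shift_left_neg_one G hl, optionEquivLeft_shift_left_one G hr])
  -- The right side is the same computation for the transposed matrices, with `n` and `m`, and the
  -- two sets of times, exchanged.
  have h2 := residue_eq_bilinearSum
    (fun i j => momentSum G (elemLeft₂ Sum.inr) (elemRight₂ Sum.inr) j i)
    (fun i j => momentSum G (elemLeft₂ Sum.inl) (elemRight₂ Sum.inr) j i)
    (fun i j => momentSum G (elemLeft₂ Sum.inl) (elemRight₂ Sum.inl) j i)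
    (fun k => MvPolynomial.X (Sum.inr (Sum.inr k)) - MvPolynomial.X (Sum.inl (Sum.inr k)))
    (miwaShift Sum.inl 0 1 (momentDet G (n + 1)) * miwaShift Sum.inr 0 (-1) (momentDet G m)) m n
    (fun i j => by
      simp only [momentSum_swap G]
      exact hasSum_schurSeries_sub_mul_momentSum _ (hr.comp Sum.inr_injective)
        (hl.comp Sum.inr_injective) (fun _ _ => Sum.inr_ne_inl) (locFinite_elemRight₂ hl)
        (locFinite_elemLeft₂ hl) i j)
    (by rw [map_mul, mul_comm, optionEquivLeft_shift_right_neg_one G hr,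
      optionEquivLeft_shift_right_one G hl])
  exact h1.trans ((bilinearSum_swap _ _ _ n m).trans h2.symm)

/-! ## Products of summable families of power series -/

section SummableProducts

variable {σ ι κ : Type*}

/-- Summability in `ℂ` is absolute, which makes the product family summable. -/
lemma hasSum_complex_mul_prod {f : ι → ℂ} {g : κ → ℂ} {a b : ℂ} (hf : HasSum f a)
    (hg : HasSum g b) : HasSum (fun p : ι × κ => f p.1 * g p.2) (a * b) :=
  hf.mul hg (summable_mul_of_summable_norm hf.summable.norm hg.summable.norm)

lemma hasSum_mul_prod {f : ι → MvPowerSeries σ ℂ} {g : κ → MvPowerSeries σ ℂ}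
    {a b : MvPowerSeries σ ℂ} (hf : HasSum f a) (hg : HasSum g b) :
    HasSum (fun p : ι × κ => f p.1 * g p.2) (a * b) := by
  classical
  have hf' := MvPowerSeries.WithPiTopology.hasSum_iff_hasSum_coeff.mp hf
  have hg' := MvPowerSeries.WithPiTopology.hasSum_iff_hasSum_coeff.mp hg
  refine MvPowerSeries.WithPiTopology.hasSum_iff_hasSum_coeff.mpr fun d => ?_
  have h : HasSum (fun p : ι × κ => ∑ e ∈ Finset.HasAntidiagonal.antidiagonal d,
      MvPowerSeries.coeff e.1 (f p.1) * MvPowerSeries.coeff e.2 (g p.2))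
      (∑ e ∈ Finset.HasAntidiagonal.antidiagonal d,
      MvPowerSeries.coeff e.1 a * MvPowerSeries.coeff e.2 b) := by
    refine hasSum_sum fun e _ => ?_
    have := hasSum_complex_mul_prod (hf' e.1) (hg' e.2)
    exact this
  rw [MvPowerSeries.coeff_mul]
  refine h.congr_fun fun p => ?_
  rw [MvPowerSeries.coeff_mul]

lemma hasSum_prod_fin (n : ℕ) {f : Fin n → ι → MvPowerSeries σ ℂ}
    {a : Fin n → MvPowerSeries σ ℂ} (h : ∀ i, HasSum (f i) (a i)) :
    HasSum (fun p : Fin n → ι => ∏ i, f i (p i)) (∏ i, a i) := by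
  induction n with
  | zero =>
    simp only [Finset.univ_eq_empty, Finset.prod_empty]
    exact hasSum_unique _
  | succ n ih =>
    rw [← (Fin.consEquiv fun _ : Fin (n + 1) => ι).hasSum_iff, Fin.prod_univ_succ]
    refine (hasSum_mul_prod (h 0) (ih fun i => h i.succ)).congr_fun fun p => ?_
    simp [Fin.prod_univ_succ, Fin.consEquiv]

end SummableProducts

/-! ## The partition function as a determinant -/

lemma sum_sign_mul_sign {n : ℕ} {R : Type*} [CommRing R] (A : Matrix (Fin n) (Fin n) R) :
    ∑ σ : Equiv.Perm (Fin n), ∑ π : Equiv.Perm (Fin n),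
      ((Equiv.Perm.sign σ : ℤ) : R) * ((Equiv.Perm.sign π : ℤ) : R) * ∏ i, A (σ i) (π i) =
      (n.factorial : R) * A.det := by
  rw [Finset.sum_comm]
  have h : ∀ π : Equiv.Perm (Fin n), ∑ σ : Equiv.Perm (Fin n),
      ((Equiv.Perm.sign σ : ℤ) : R) * ((Equiv.Perm.sign π : ℤ) : R) * ∏ i, A (σ i) (π i) =
      A.det := by
    intro π
    rw [Matrix.det_apply', ← Equiv.sum_comp (Equiv.mulRight π)]
    refine Finset.sum_congr rfl fun σ _ => ?_
    rw [← Equiv.prod_comp π fun i => A (σ i) i]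
    simp only [Equiv.coe_mulRight, Equiv.Perm.sign_mul, Units.val_mul, Int.cast_mul,
      Equiv.Perm.mul_apply]
    rw [mul_assoc ((Equiv.Perm.sign σ : ℤ) : R), ← Int.cast_mul, Int.units_coe_mul_self,
      Int.cast_one, mul_one]
  rw [Finset.sum_congr rfl fun π _ => h π, Finset.sum_const, Finset.card_univ, Fintype.card_perm,
    Fintype.card_fin, nsmul_eq_mul]

/-- The opposite sign convention enters once in each factor and cancels. -/
lemma vand_mul_vand {n : ℕ} (x y : Fin n → ℂ) :
    vand x * vand y = (Matrix.vandermonde x).det * (Matrix.vandermonde y).det := by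
  rw [Matrix.det_vandermonde, Matrix.det_vandermonde, vand, vand, ← Finset.prod_mul_distrib,
    ← Finset.prod_mul_distrib]
  refine Finset.prod_congr rfl fun i _ => ?_
  rw [← Finset.prod_mul_distrib, ← Finset.prod_mul_distrib]
  refine Finset.prod_congr rfl fun j _ => ?_
  ring

lemma det_vandermonde_eq_sum {n : ℕ} (x : Fin n → ℂ) :
    (Matrix.vandermonde x).det = ∑ σ : Equiv.Perm (Fin n),
      ((Equiv.Perm.sign σ : ℤ) : ℂ) * ∏ i, x i ^ (σ i : ℕ) := by
  rw [← Matrix.det_transpose, Matrix.det_apply']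
  rfl

lemma coeff_momentSum (G : ℕ → ℕ → ℂ) (i j : ℕ) (d : Time →₀ ℕ) :
    MvPowerSeries.coeff d (momentSum G elemLeft elemRight i j) =
      G (i + weightLeft d) (j + weightRight d) * invFactorial d := by
  have h := MvPowerSeries.WithPiTopology.hasSum_iff_hasSum_coeff.mp
    (hasSum_momentSum G locFinite_elemLeft locFinite_elemRight i j) d
  refine h.unique ?_
  have h2 := hasSum_single (f := fun p : ℕ × ℕ => MvPowerSeries.coeff d
    (MvPowerSeries.C (G (i + p.1) (j + p.2)) * (elemLeft p.1 * elemRight p.2)))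
    (weightLeft d, weightRight d) ?_
  · rw [MvPowerSeries.coeff_C_mul, coeff_elemLeft_mul_elemRight, if_pos ⟨rfl, rfl⟩] at h2
    exact h2
  · rintro ⟨a, b⟩ hne
    rw [MvPowerSeries.coeff_C_mul, coeff_elemLeft_mul_elemRight, if_neg, mul_zero]
    rintro ⟨rfl, rfl⟩
    exact hne rfl

section Model

variable {q₁ q₂ : ℂ} {V : ℕ → ℕ → WithBot ℂ}

/-- On the monomial `d` this is the bimoment series with both indices raised by the weights of `d`,
up to the factor `1 / d!`. -/
lemma hasSum_expXi (hg : ∀ k m : ℕ, Summable (bimomentTerm q₁ q₂ V k m)) (i j : ℕ) :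
    HasSum (fun p : ℕ × ℕ => MvPowerSeries.C ((q₁ ^ p.1) ^ i * (q₂ ^ p.2) ^ j) *
        (expXi (q₁ ^ p.1) (q₂ ^ p.2) * MvPowerSeries.C (expPot (V p.1 p.2))))
      (momentSum (bimoment q₁ q₂ V) elemLeft elemRight i j) := by
  rw [MvPowerSeries.WithPiTopology.hasSum_iff_hasSum_coeff]
  intro d
  rw [coeff_momentSum]
  refine ((hg (i + weightLeft d) (j + weightRight d)).hasSum.mul_right _).congr_fun fun p => ?_
  rw [MvPowerSeries.coeff_C_mul, MvPowerSeries.coeff_mul_C, coeff_expXi, expXiCoeff, bimomentTerm]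
  simp only [← pow_mul, add_mul, pow_add, mul_comm p.1, mul_comm p.2]
  ring

lemma modelTerm_eq_sum (n : ℕ) (h h' : Fin n → ℕ) :
    modelTerm q₁ q₂ V n h h' = ∑ σ : Equiv.Perm (Fin n), ∑ π : Equiv.Perm (Fin n),
      ((Equiv.Perm.sign σ : ℤ) : MvPowerSeries Time ℂ) *
        ((Equiv.Perm.sign π : ℤ) : MvPowerSeries Time ℂ) *
        ∏ i, (MvPowerSeries.C ((q₁ ^ h i) ^ (σ i : ℕ) * (q₂ ^ h' i) ^ (π i : ℕ)) *
          (expXi (q₁ ^ h i) (q₂ ^ h' i) * MvPowerSeries.C (expPot (V (h i) (h' i))))) := by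
  rw [modelTerm, vand_mul_vand, det_vandermonde_eq_sum, det_vandermonde_eq_sum,
    Finset.sum_mul_sum, map_sum, Finset.sum_mul]
  refine Finset.sum_congr rfl fun σ _ => ?_
  rw [map_sum, Finset.sum_mul]
  refine Finset.sum_congr rfl fun π _ => ?_
  simp only [Finset.prod_mul_distrib, map_mul, map_prod, map_intCast]
  ring

/-- Andréief's identity: for each pair of permutations the sum over tuples of pairs is a product of
`n` independent sums. -/
lemma hasSum_modelTerm (hg : ∀ k m : ℕ, Summable (bimomentTerm q₁ q₂ V k m)) (n : ℕ) :
    HasSum (fun p : (Fin n → ℕ) × (Fin n → ℕ) => modelTerm q₁ q₂ V n p.1 p.2)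
      ((n.factorial : MvPowerSeries Time ℂ) * momentDet (bimoment q₁ q₂ V) n) := by
  rw [momentDet, ← sum_sign_mul_sign,
    ← (Equiv.arrowProdEquivProdArrow (Fin n) (fun _ => ℕ) fun _ => ℕ).hasSum_iff]
  refine HasSum.congr_fun (hasSum_sum fun σ _ => hasSum_sum fun π _ =>
    (hasSum_prod_fin n fun i => hasSum_expXi hg (σ i) (π i)).mul_left _) fun p => ?_
  exact modelTerm_eq_sum n _ _

theorem partitionFn_eq_momentDet (hg : ∀ k m : ℕ, Summable (bimomentTerm q₁ q₂ V k m)) :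
    partitionFn q₁ q₂ V = momentDet (bimoment q₁ q₂ V) := by
  funext n
  rw [partitionFn, (hasSum_modelTerm hg n).tsum_eq, ← mul_assoc]
  have h : (n.factorial : MvPowerSeries Time ℂ) = MvPowerSeries.C (n.factorial : ℂ) := by simp
  rw [h, ← map_mul, one_div_mul_cancel (Nat.cast_ne_zero.mpr n.factorial_ne_zero), map_one,
    one_mul]

end Model

/-! ## Partitions of length at most `n` as strictly decreasing sequences -/

section Partitions

variable {n : ℕ}

lemma rowLen_eq_zero {μ : YoungDiagram} {i : ℕ} (hi : μ.colLen 0 ≤ i) : μ.rowLen i = 0 := by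
  by_contra h
  have h1 : (i, 0) ∈ μ := YoungDiagram.mem_iff_lt_rowLen.mpr (Nat.pos_of_ne_zero h)
  exact absurd (YoungDiagram.mem_iff_lt_colLen.mp h1) (by omega)

lemma strictAnti_shiftedPart (μ : PartitionLE n) : StrictAnti (shiftedPart μ) := by
  intro i j hij
  have h := μ.1.rowLen_anti i j (Fin.le_def.mp hij.le)
  have h2 := Fin.lt_def.mp hij
  have h3 := j.2
  simp only [shiftedPart]
  omega

lemma shiftedPart_injective : Function.Injective (shiftedPart (n := n)) := by
  intro μ ν h
  have hrow : ∀ i, μ.1.rowLen i = ν.1.rowLen i := by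
    intro i
    rcases lt_or_ge i n with hi | hi
    · have := congrFun h ⟨i, hi⟩
      simpa [shiftedPart] using this
    · rw [rowLen_eq_zero (μ.2.trans hi), rowLen_eq_zero (ν.2.trans hi)]
  refine Subtype.ext (YoungDiagram.ext (Finset.ext fun c => ?_))
  rw [YoungDiagram.mem_cells, YoungDiagram.mem_cells]
  rcases c with ⟨i, j⟩
  rw [YoungDiagram.mem_iff_lt_rowLen, YoungDiagram.mem_iff_lt_rowLen, hrow]

lemma exists_rowLen_eq (g : ℕ → ℕ) (hg : Antitone g) (h0 : ∀ i, n ≤ i → g i = 0) :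
    ∃ μ : PartitionLE n, ∀ i, μ.1.rowLen i = g i := by
  set μ : YoungDiagram :=
    { cells := (Finset.range n ×ˢ Finset.range (g 0)).filter fun c => c.2 < g c.1
      isLowerSet := by
        rintro ⟨i, j⟩ ⟨i', j'⟩ ⟨hi, hj⟩ h
        simp only [Finset.coe_filter, Finset.mem_product, Finset.mem_range, Set.mem_ofPred_eq]
          at h hi hj ⊢
        have := hg hi
        exact ⟨⟨by omega, by omega⟩, by omega⟩ } with hμ
  have hmem : ∀ i j, (i, j) ∈ μ ↔ j < g i := by
    intro i j
    rw [← YoungDiagram.mem_cells, hμ]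
    simp only [Finset.mem_filter, Finset.mem_product, Finset.mem_range, and_iff_right_iff_imp]
    intro h
    refine ⟨?_, h.trans_le (hg (Nat.zero_le i))⟩
    by_contra hi
    rw [h0 i (not_lt.mp hi)] at h
    omega
  refine ⟨⟨μ, ?_⟩, fun i => ?_⟩
  · by_contra h
    have := (hmem n 0).mp (YoungDiagram.mem_iff_lt_colLen.mpr (not_le.mp h))
    rw [h0 n le_rfl] at this
    omega
  · have h : ∀ j, j < μ.rowLen i ↔ j < g i := fun j => by
      rw [← YoungDiagram.mem_iff_lt_rowLen, hmem]
    have h1 := h (g i)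
    have h2 := h (μ.rowLen i)
    simp only
    omega

lemma exists_shiftedPart_eq {f : Fin n → ℕ} (hf : StrictAnti f) :
    ∃ μ : PartitionLE n, shiftedPart μ = f := by
  -- Counted from the end, the `k`-th value is at least `k`; hence the subtraction defining the
  -- parts below is not truncated.
  have hge : ∀ k (hk : k < n), k ≤ f (Fin.rev ⟨k, hk⟩) := by
    intro k
    induction k with
    | zero => exact fun _ => Nat.zero_le _
    | succ k ih =>
      intro hk
      refine Nat.succ_le_of_lt ((ih (by omega)).trans_lt (hf ?_))
      rw [Fin.rev_lt_rev, Fin.mk_lt_mk]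
      omega
  have hge' : ∀ i : Fin n, n - 1 - (i : ℕ) ≤ f i := by
    intro i
    have h := hge (n - 1 - i) (by have := i.2; omega)
    have e : Fin.rev (⟨n - 1 - i, by have := i.2; omega⟩ : Fin n) = i := by
      ext
      simp only [Fin.val_rev]
      have := i.2
      omega
    rwa [e] at h
  set g : ℕ → ℕ := fun i => if h : i < n then f ⟨i, h⟩ - (n - 1 - i) else 0 with hg
  obtain ⟨μ, hμ⟩ := exists_rowLen_eq (n := n) g (antitone_nat_of_succ_le fun i => by
    simp only [hg]
    split_ifs with h1 h2
    · have h3 : f ⟨i + 1, h1⟩ < f ⟨i, h2⟩ := hf (by rw [Fin.mk_lt_mk]; omega)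
      omega
    all_goals omega) fun i hi => dif_neg (by omega)
  refine ⟨μ, funext fun i => ?_⟩
  rw [shiftedPart, hμ, hg]
  simp only [i.2, dif_pos]
  exact Nat.sub_add_cancel (hge' i)

lemma exists_shiftedPart_comp_eq {k : Fin n → ℕ} (hk : Function.Injective k) :
    ∃ (μ : PartitionLE n) (σ : Equiv.Perm (Fin n)), shiftedPart μ ∘ σ = k := by
  have hm : StrictMono (k ∘ Tuple.sort k) :=
    (Tuple.monotone_sort k).strictMono_of_injective (hk.comp (Tuple.sort k).injective)
  obtain ⟨μ, hμ⟩ := exists_shiftedPart_eq (f := (k ∘ Tuple.sort k) ∘ Fin.rev)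
    fun i j hij => hm (Fin.rev_lt_rev.mpr hij)
  refine ⟨μ, (Tuple.sort k).symm.trans Fin.revPerm, ?_⟩
  rw [hμ]
  ext i
  simp

lemma shiftedPart_comp_injective : Function.Injective
    fun p : PartitionLE n × Equiv.Perm (Fin n) => shiftedPart p.1 ∘ p.2 := by
  rintro ⟨μ, σ⟩ ⟨ν, π⟩ h
  simp only at h
  have hrange : Set.range (shiftedPart μ ∘ Fin.rev) = Set.range (shiftedPart ν ∘ Fin.rev) := by
    rw [Fin.rev_surjective.range_comp, Fin.rev_surjective.range_comp,
      ← σ.surjective.range_comp (shiftedPart μ), h, π.surjective.range_comp]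
  have hmono : ∀ μ : PartitionLE n, StrictMono (shiftedPart μ ∘ Fin.rev) := fun μ i j hij =>
    strictAnti_shiftedPart μ (Fin.rev_lt_rev.mpr hij)
  have h1 : shiftedPart μ ∘ Fin.rev = shiftedPart ν ∘ Fin.rev :=
    (StrictMono.range_inj (hmono μ) (hmono ν)).mp hrange
  obtain rfl : μ = ν := shiftedPart_injective (Fin.rev_surjective.injective_comp_right h1)
  have h2 : σ = π := Equiv.ext fun i =>
    (strictAnti_shiftedPart μ).injective (congrFun h i)
  rw [h2]

end Partitions

/-! ## Schur functions as minors of `U(t)` -/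

lemma elemSchur_of_neg {k : ℤ} (hk : k < 0) : elemSchur k = 0 := if_neg hk.not_ge

/-- A row beyond the length has entries `h_{j-n}`: zero left of the diagonal and `1` on it. -/
lemma schur_eq_det (μ : YoungDiagram) {n : ℕ} (hn : μ.colLen 0 ≤ n) :
    schur μ = Matrix.det (Matrix.of fun i j : Fin n =>
      elemSchur ((μ.rowLen i : ℤ) - (i : ℕ) + (j : ℕ))) := by
  induction n, hn using Nat.le_induction with
  | base => rfl
  | succ n hn ih =>
    rw [ih, Matrix.det_succ_row _ (Fin.last n), Fin.sum_univ_castSucc, Finset.sum_eq_zero,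
      zero_add]
    · rw [Matrix.of_apply, Fin.val_last, rowLen_eq_zero hn, ← two_mul, pow_mul, neg_one_sq, one_pow,
        one_mul]
      have h : elemSchur (((0 : ℕ) : ℤ) - (n : ℕ) + (n : ℕ)) = 1 := by
        simp [elemSchur, elemSchurNat_zero]
      rw [h, one_mul]
      congr 1
      ext1 i j
      simp
    · intro j _
      rw [Matrix.of_apply, Fin.val_last, rowLen_eq_zero hn, elemSchur_of_neg, mul_zero, zero_mul]
      have := j.2
      simp only [Fin.val_castSucc]
      omega

/-- The entry `f_{k - i}` of `U(f)`. -/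
noncomputable def toeplitz {σ : Type*} (f : ℕ → MvPowerSeries σ ℂ) (i k : ℕ) :
    MvPowerSeries σ ℂ :=
  if i ≤ k then f (k - i) else 0

lemma coe_rename_schur {n : ℕ} (e : ℕ+ → Time) (μ : PartitionLE n) :
    ((MvPolynomial.rename e (schur μ.1) : MvPolynomial Time ℂ) : MvPowerSeries Time ℂ) =
      Matrix.det (Matrix.of fun i j : Fin n =>
        toeplitz (schurSeries fun m => MvPolynomial.X (e m)) (Fin.rev i) (shiftedPart μ j)) := by
  rw [schur_eq_det μ.1 μ.2, ← Matrix.det_transpose, AlgHom.map_det,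
    ← MvPolynomial.coeToMvPowerSeries.ringHom_apply, RingHom.map_det]
  congr 1
  ext1 i j
  simp only [AlgHom.mapMatrix_apply, RingHom.mapMatrix_apply, Matrix.map_apply,
    Matrix.transpose_apply, Matrix.of_apply, toeplitz, MvPolynomial.coeToMvPowerSeries.ringHom_apply]
  have hi := i.2
  have hj := j.2
  split_ifs with h
  · simp only [shiftedPart, Fin.val_rev] at h ⊢
    have e1 : ((μ.1.rowLen j : ℤ) - (j : ℕ) + (i : ℕ)) =
        ((μ.1.rowLen j + (n - 1 - j) - (n - (i + 1)) : ℕ) : ℤ) := by omega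
    rw [e1]
    simp only [elemSchur, Nat.cast_nonneg, if_true, Int.toNat_natCast, schurSeries]
    rw [MvPolynomial.aeval_unique (MvPolynomial.rename e)]
    simp only [Function.comp_def, MvPolynomial.rename_X]
  · simp only [shiftedPart, Fin.val_rev] at h
    rw [elemSchur_of_neg (by omega), map_zero, MvPolynomial.coe_zero]

/-! ## The Cauchy–Binet expansion -/

lemma hasSum_toeplitz (G : ℕ → ℕ → ℂ) (i j : ℕ) :
    HasSum (fun p : ℕ × ℕ => MvPowerSeries.C (G p.1 p.2) *
      (toeplitz elemLeft i p.1 * toeplitz elemRight j p.2))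
      (momentSum G elemLeft elemRight i j) := by
  have hinj : Function.Injective fun p : ℕ × ℕ => (i + p.1, j + p.2) := fun p q hpq => by
    simp only [Prod.mk.injEq, add_right_inj] at hpq
    exact Prod.ext hpq.1 hpq.2
  refine (hinj.hasSum_iff ?_).mp
    ((hasSum_momentSum G locFinite_elemLeft locFinite_elemRight i j).congr_fun fun p => ?_)
  · rintro ⟨a, b⟩ hab
    simp only [toeplitz]
    split_ifs with h1 h2
    · exact absurd ⟨(a - i, b - j), by simp [h1, h2]⟩ hab
    all_goals simp
  · simp [toeplitz]

lemma hasSum_det_toeplitz (G : ℕ → ℕ → ℂ) (n : ℕ) :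
    HasSum (fun p : (Fin n → ℕ) × (Fin n → ℕ) =>
      MvPowerSeries.C (Matrix.det (Matrix.of fun i j => G (p.1 i) (p.2 j))) *
        ((∏ i, toeplitz elemLeft (Fin.rev i) (p.1 i)) *
          ∏ i, toeplitz elemRight (Fin.rev i) (p.2 i)))
      (momentDet G n) := by
  -- Rows and columns are both reversed, at no cost in sign, to match the decreasing order of the
  -- shifted parts.
  rw [momentDet, ← Matrix.det_submatrix_equiv_self Fin.revPerm, Matrix.det_apply']
  have key : ∀ σ : Equiv.Perm (Fin n), HasSum (fun p : (Fin n → ℕ) × (Fin n → ℕ) =>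
      ((Equiv.Perm.sign σ : ℤ) : MvPowerSeries Time ℂ) *
        ∏ i, (MvPowerSeries.C (G (p.1 (σ i)) (p.2 i)) *
          (toeplitz elemLeft (Fin.rev (σ i)) (p.1 (σ i)) *
            toeplitz elemRight (Fin.rev i) (p.2 i))))
      (((Equiv.Perm.sign σ : ℤ) : MvPowerSeries Time ℂ) *
        ∏ i, momentSum G elemLeft elemRight (Fin.rev (σ i)) (Fin.rev i)) := by
    intro σ
    have h := (hasSum_prod_fin n fun i : Fin n =>
      hasSum_toeplitz G (Fin.rev (σ i)) (Fin.rev i)).mul_left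
        ((Equiv.Perm.sign σ : ℤ) : MvPowerSeries Time ℂ)
    -- The left tuple is permuted by `σ`, separately for each `σ`; the Toeplitz product then no
    -- longer depends on `σ`, and the signed sum becomes a determinant of `G`.
    rw [← (((Equiv.arrowCongr σ.symm (Equiv.refl ℕ)).prodCongr (Equiv.refl (Fin n → ℕ))).trans
      (Equiv.arrowProdEquivProdArrow (Fin n) (fun _ => ℕ) fun _ => ℕ).symm).hasSum_iff] at h
    exact h
  refine (hasSum_sum fun σ _ => key σ).congr_fun fun p => ?_
  rw [Matrix.det_apply', map_sum, Finset.sum_mul]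
  refine Finset.sum_congr rfl fun σ _ => ?_
  rw [Finset.prod_mul_distrib, Finset.prod_mul_distrib, map_mul, map_intCast, map_prod,
    Equiv.prod_comp σ fun i => toeplitz elemLeft (Fin.rev i) (p.1 i), mul_assoc]
  rfl

theorem hasTakasakiForm_momentDet (G : ℕ → ℕ → ℂ) : HasTakasakiForm (momentDet G) G := by
  intro n
  have hsum := hasSum_det_toeplitz G n
  set F : (Fin n → ℕ) × (Fin n → ℕ) → MvPowerSeries Time ℂ := fun p =>
      MvPowerSeries.C (Matrix.det (Matrix.of fun i j => G (p.1 i) (p.2 j))) *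
        ((∏ i, toeplitz elemLeft (Fin.rev i) (p.1 i)) *
          ∏ i, toeplitz elemRight (Fin.rev i) (p.2 i)) with hF
  set e : (PartitionLE n × PartitionLE n) × (Equiv.Perm (Fin n) × Equiv.Perm (Fin n)) →
      (Fin n → ℕ) × (Fin n → ℕ) := fun x =>
    (shiftedPart x.1.1 ∘ x.2.1, shiftedPart x.1.2 ∘ x.2.2) with he
  have hinj : Function.Injective e := by
    rintro ⟨⟨μ, ν⟩, ⟨σ, π⟩⟩ ⟨⟨μ', ν'⟩, ⟨σ', π'⟩⟩ h
    simp only [he, Prod.mk.injEq] at h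
    have h1 := shiftedPart_comp_injective (a₁ := (μ, σ)) (a₂ := (μ', σ')) h.1
    have h2 := shiftedPart_comp_injective (a₁ := (ν, π)) (a₂ := (ν', π')) h.2
    simp only [Prod.mk.injEq] at h1 h2 ⊢
    exact ⟨⟨h1.1, h2.1⟩, ⟨h1.2, h2.2⟩⟩
  -- Tuples without repetitions are exactly the rearrangements of shifted parts; a repetition gives
  -- the determinant of `G` two equal rows or columns.
  have hrange : ∀ p ∉ Set.range e, F p = 0 := by
    rintro ⟨k, m⟩ hp
    simp only [hF]
    by_cases hk : Function.Injective k
    · by_cases hm : Function.Injective m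
      · obtain ⟨μ, σ, hμ⟩ := exists_shiftedPart_comp_eq hk
        obtain ⟨ν, π, hν⟩ := exists_shiftedPart_comp_eq hm
        exact absurd ⟨((μ, ν), (σ, π)), Prod.ext hμ hν⟩ hp
      · obtain ⟨i, j, hij, hne⟩ := Function.not_injective_iff.mp hm
        rw [Matrix.det_zero_of_column_eq hne (fun l => by simp [hij]), map_zero, zero_mul]
    · obtain ⟨i, j, hij, hne⟩ := Function.not_injective_iff.mp hk
      rw [Matrix.det_zero_of_row_eq hne (by ext l; simp [hij]), map_zero, zero_mul]
  have h := ((hinj.hasSum_iff hrange).mpr hsum).prod_fiberwise fun _ => hasSum_fintype _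
  refine h.congr_fun fun p => ?_
  -- The two signs produced by rearranging `G` are those in the Leibniz expansions of the two Schur
  -- functions.
  have hdet : ∀ σ π : Equiv.Perm (Fin n), Matrix.det (Matrix.of fun i j =>
      G (shiftedPart p.1 (σ i)) (shiftedPart p.2 (π j))) =
      ((Equiv.Perm.sign σ : ℤ) : ℂ) * ((Equiv.Perm.sign π : ℤ) : ℂ) * coeffDet G p.1 p.2 := by
    intro σ π
    have h1 := Matrix.det_permute σ ((Matrix.of fun i j : Fin n =>
      G (shiftedPart p.1 i) (shiftedPart p.2 j)).submatrix id π)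
    have h2 := Matrix.det_permute' π (Matrix.of fun i j : Fin n =>
      G (shiftedPart p.1 i) (shiftedPart p.2 j))
    rw [coeffDet, mul_assoc, ← h2, ← h1]
    rfl
  have hL := coe_rename_schur Sum.inl p.1
  have hR := coe_rename_schur Sum.inr p.2
  rw [schurLeft, schurRight, hL, hR, ← Matrix.det_transpose, Matrix.det_apply',
    ← Matrix.det_transpose (Matrix.of fun i j : Fin n =>
      toeplitz (schurSeries fun m => MvPolynomial.X (Sum.inr m)) (Fin.rev i) (shiftedPart p.2 j)),
    Matrix.det_apply', mul_assoc, Finset.sum_mul_sum, Finset.mul_sum, Fintype.sum_prod_type]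
  refine Finset.sum_congr rfl fun σ _ => ?_
  rw [Finset.mul_sum]
  refine Finset.sum_congr rfl fun π _ => ?_
  simp only [he, hF, Function.comp_apply, hdet, map_mul, map_intCast, Matrix.transpose_apply,
    Matrix.of_apply, elemLeft, elemRight]
  ring

end DiscreteToda

/-! ### The discrete model as a Toda tau function -/

theorem theorem2 (q₁ q₂ : ℂ) (V : ℕ → ℕ → WithBot ℂ)
    (hg : ∀ k m : ℕ, Summable (DiscreteToda.bimomentTerm q₁ q₂ V k m)) :
    (∀ n : ℕ, Summable fun p : (Fin n → ℕ) × (Fin n → ℕ) =>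
        DiscreteToda.modelTerm q₁ q₂ V n p.1 p.2) ∧
      DiscreteToda.HasTakasakiForm (DiscreteToda.partitionFn q₁ q₂ V)
        (DiscreteToda.bimoment q₁ q₂ V) ∧
      DiscreteToda.IsSemiInfiniteTodaTau (DiscreteToda.partitionFn q₁ q₂ V) := by
  rw [DiscreteToda.partitionFn_eq_momentDet hg]
  exact ⟨fun n => (DiscreteToda.hasSum_modelTerm hg n).summable,
    DiscreteToda.hasTakasakiForm_momentDet _, DiscreteToda.isSemiInfiniteTodaTau_momentDet _⟩
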